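/- Let $k$ be a field with $\mathrm{char}(k)\neq 2$ and let $A=A_+\oplus A_-$ be a super-affine Hopf algebra over $k$: a finitely generated super-commutative $k$-superalgebra with a coassociative comultiplication $m^*:A\to A\otimes^\varepsilon A$, a counit $e^*:A\to k$ and an antipode $i^*:A\to A$ which are morphisms of superalgebras; here $\otimes^\varepsilon$ is the tensor product with the sign rule $(a\otimes b)(a'\otimes b')=(-1)^{|b||a'|}aa'\otimes bb'$. Let $J$ be the super radical of $A$, i.e. the ideal generated by $A_-$, let $\pi:A\to B=A/J$ be the quotient map and $G=\mathrm{Spec}(B)$. Then $A$ is a $B$-comodule via $\Delta=(\mathrm{id}\otimes\pi)\circ m^*$, with quotient comodule $J/J^2$ of its subcomodule $J$, and for a $B$-comodule $(V,\Delta_V)$ we put $V^G=\{v\in V:\Delta_V(v)=v\otimes 1\}$. Let $\mathfrak g_-$ be the space of odd left-invariant $k$-superderivations of $A$ (odd $k$-linear $D:A\to A$ with $D(ab)=D(a)b+(-1)^{|a|}aD(b)$ for homogeneous $a$ and $m^*\circ D=(\mathrm{id}\otimes^\varepsilon D)\circ m^*$); it is finite dimensional, and we put $s=\dim_k\mathfrak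 g_-$. Assume $\mathrm{char}(k)=0$ or $\mathrm{char}(k)>s$. There exist odd elements $\theta_1,\dots,\theta_s\in A^G$ whose classes modulo $J^2$ form a $k$-basis of $(J/J^2)^G$, together with odd right-invariant superderivations $D'_1,\dots,D'_s$ of $A$ (that is, $m^*\circ D'_i=(D'_i\otimes\mathrm{id})\circ m^*$) such that $e^*(D'_i(\theta_j))=\delta_{ij}$. For every such choice put $D(x)=\sum_{i=1}^s\theta_i D'_i(x)$ and $\tilde B=\ker(D:A\to A)$. Then $A^G$ and $\tilde B$ are graded $k$-subalgebras of $A$, and: 1. $\tilde B\subset A_+$, and $\pi$ restricts to an (even) isomorphism of $k$-algebras $\tilde B\cong B$; 2. multiplication is an isomorphism of $k$-superalgebras $A^G\otimes^\varepsilon\tilde B\cong A$; 3. the superpolynomial ring $k[\theta_1,\dots,\theta_s]$ in $s$ odd variables (the exterior algebra on $k^s$) maps isomorphically onto $A^G$, its $i$-th variable going to the element $\theta_i\in A^G$; hence, again by multiplication, $k[\theta_1,\dots,\theta_s]\otimes^\varepsilon\tilde B\cong A$ as $k$-superalgebras. -/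

import Mathlib

open scoped TensorProduct

noncomputable section

namespace SuperHopf

variable {k : Type*} [Field k]

/-- The total `ℤ/2`-grading on the tensor product of two `ℤ/2`-graded algebras: the degree `i`
part is spanned by the tensors `a ⊗ b` with `a`, `b` homogeneous and `|a| + |b| = i`. -/
def tensorGrading {A B : Type*} [Ring A] [Algebra k A] [Ring B] [Algebra k B]
    (𝒜 : ZMod 2 → Submodule k A) (ℬ : ZMod 2 → Submodule k B)
    [GradedAlgebra 𝒜] [GradedAlgebra ℬ] (i : ZMod 2) : Submodule k (𝒜 ᵍ⊗[k] ℬ) :=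
  Submodule.span k
    {t | ∃ p q : ZMod 2, p + q = i ∧ ∃ a ∈ 𝒜 p, ∃ b ∈ ℬ q, t = GradedTensorProduct.tmul k a b}

/-- An isomorphism of superalgebras: an isomorphism of algebras matching the gradings. -/
def IsEvenEquiv {A B : Type*} [Ring A] [Algebra k A] [Ring B] [Algebra k B]
    (𝒜 : ZMod 2 → Submodule k A) (ℬ : ZMod 2 → Submodule k B) (e : A ≃ₐ[k] B) : Prop :=
  ∀ i, (𝒜 i).map e.toAlgHom.toLinearMap = ℬ i

/-- The grading `i ↦ S ∩ 𝒜 i` on a subalgebra `S`. -/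
def inducedGrading {A : Type*} [Ring A] [Algebra k A]
    (𝒜 : ZMod 2 → Submodule k A) (S : Subalgebra k A) (i : ZMod 2) : Submodule k S :=
  (𝒜 i).comap S.val.toLinearMap

section

variable {A : Type*} [Ring A] [Algebra k A]

/-- Super-commutativity `x y = (-1)^{|x||y|} y x`; the sign is nontrivial only for two odd
elements. -/
class IsSuperCommutative (𝒜 : ZMod 2 → Submodule k A) : Prop where
  mul_comm_of_even : ∀ i, ∀ a ∈ 𝒜 0, ∀ b ∈ 𝒜 i, a * b = b * a
  mul_comm_of_odd : ∀ a ∈ 𝒜 1, ∀ b ∈ 𝒜 1, a * b = -(b * a)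

variable (𝒜 : ZMod 2 → Submodule k A)

/-- A super-affine Hopf algebra over `k`: a finitely generated super-commutative `k`-algebra with
a coassociative counital coalgebra structure (the class `Coalgebra k A`) whose comultiplication
`A → A ⊗^ε A`, counit `A → k` and antipode `A → A` are morphisms of superalgebras. -/
class IsSuperAffineHopfAlgebra [GradedAlgebra 𝒜] [Coalgebra k A] : Prop
    extends IsSuperCommutative 𝒜 where
  finiteType : Algebra.FiniteType k A
  comul_one : GradedTensorProduct.of k 𝒜 𝒜 (Coalgebra.comul (1 : A)) = 1
  comul_mul : ∀ a b : A,
    GradedTensorProduct.of k 𝒜 𝒜 (Coalgebra.comul (a * b)) =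
      GradedTensorProduct.of k 𝒜 𝒜 (Coalgebra.comul a) *
        GradedTensorProduct.of k 𝒜 𝒜 (Coalgebra.comul b)
  comul_mem : ∀ i, ∀ a ∈ 𝒜 i,
    GradedTensorProduct.of k 𝒜 𝒜 (Coalgebra.comul a) ∈ tensorGrading 𝒜 𝒜 i
  counit_one : Coalgebra.counit (R := k) (1 : A) = 1
  counit_mul : ∀ a b : A, Coalgebra.counit (R := k) (a * b) =
    Coalgebra.counit (R := k) a * Coalgebra.counit (R := k) b
  counit_odd : ∀ a ∈ 𝒜 1, Coalgebra.counit (R := k) a = 0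
  exists_antipode : ∃ S : A →ₐ[k] A, (∀ i, ∀ a ∈ 𝒜 i, S a ∈ 𝒜 i) ∧
    (∀ a : A, LinearMap.mul' k A (S.toLinearMap.rTensor A (Coalgebra.comul a)) =
      algebraMap k A (Coalgebra.counit a)) ∧
    (∀ a : A, LinearMap.mul' k A (S.toLinearMap.lTensor A (Coalgebra.comul a)) =
      algebraMap k A (Coalgebra.counit a))

/-- The super radical `J`: the ideal generated by the odd part `𝒜 1`. By super-commutativity the
left ideal generated by `𝒜 1` is two-sided, see the instance below. -/
def superRadical : Ideal A := Ideal.span (𝒜 1 : Set A)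

instance superRadical_isTwoSided [GradedAlgebra 𝒜] [IsSuperCommutative 𝒜] :
    (superRadical 𝒜).IsTwoSided := by
  classical
  refine ⟨fun {a} b ha => ?_⟩
  have hb : b = (DirectSum.decompose 𝒜 b 0 : A) + (DirectSum.decompose 𝒜 b 1 : A) := by
    conv_lhs => rw [← DirectSum.sum_support_decompose 𝒜 b]
    rw [Finset.sum_subset (Finset.subset_univ _)]
    · exact Fin.sum_univ_two _
    · intro i _ hi
      simpa using hi
  unfold superRadical at ha ⊢
  induction ha using Submodule.span_induction with
  | mem x hx =>
    rw [hb, mul_add,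
      ← IsSuperCommutative.mul_comm_of_even 1 _ (DirectSum.decompose 𝒜 b 0).2 x hx,
      IsSuperCommutative.mul_comm_of_odd x hx _ (DirectSum.decompose 𝒜 b 1).2]
    exact add_mem (Ideal.mul_mem_left _ _ (Ideal.subset_span hx))
      (neg_mem (Ideal.mul_mem_left _ _ (Ideal.subset_span hx)))
  | zero => simp
  | add x y _ _ h1 h2 => rw [add_mul]; exact add_mem h1 h2
  | smul c x _ h => rw [smul_eq_mul, mul_assoc]; exact Ideal.mul_mem_left _ _ h

variable [GradedAlgebra 𝒜]

/-- The parity involution `a ↦ (-1)^{|a|} a`. -/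
def parity : A →ₗ[k] A := GradedAlgebra.proj 𝒜 0 - GradedAlgebra.proj 𝒜 1

/-- Odd `k`-linear superderivations of `A`: odd maps `D` with
`D (a b) = D a · b + (-1)^{|a|} a · D b`. -/
def oddSuperDer : Submodule k (A →ₗ[k] A) where
  carrier := {D | (∀ i, ∀ a ∈ 𝒜 i, D a ∈ 𝒜 (i + 1)) ∧
    ∀ a b, D (a * b) = D a * b + parity 𝒜 a * D b}
  add_mem' := by
    rintro D E ⟨hD, hD'⟩ ⟨hE, hE'⟩
    refine ⟨fun i a ha => add_mem (hD i a ha) (hE i a ha), fun a b => ?_⟩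
    simp only [LinearMap.add_apply, hD', hE', add_mul, mul_add]
    abel
  zero_mem' := ⟨fun i a _ => by simp, fun a b => by simp⟩
  smul_mem' := by
    rintro c D ⟨hD, hD'⟩
    refine ⟨fun i a ha => Submodule.smul_mem _ c (hD i a ha), fun a b => ?_⟩
    simp only [LinearMap.smul_apply, hD', smul_add, smul_mul_assoc, mul_smul_comm]

variable [Coalgebra k A]

/-- `𝔤_-`, the odd part of `Lie(A)`: odd superderivations `D` that are left-invariant, i.e.
`Δ ∘ D = (id ⊗^ε D) ∘ Δ`. By the sign rule `(id ⊗^ε D)(a ⊗ b) = (-1)^{|a|} a ⊗ D b` as `D` is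
odd. -/
def gMinus : Submodule k (A →ₗ[k] A) where
  carrier := {D | D ∈ oddSuperDer 𝒜 ∧
    Coalgebra.comul ∘ₗ D = TensorProduct.map (parity 𝒜) D ∘ₗ Coalgebra.comul}
  add_mem' := by
    rintro D E ⟨hD, hD'⟩ ⟨hE, hE'⟩
    refine ⟨add_mem hD hE, ?_⟩
    rw [LinearMap.comp_add, hD', hE', TensorProduct.map_add_right, LinearMap.add_comp]
  zero_mem' := ⟨zero_mem _, by simp [TensorProduct.map_zero_right]⟩
  smul_mem' := by
    rintro c D ⟨hD, hD'⟩
    refine ⟨Submodule.smul_mem _ c hD, ?_⟩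
    rw [LinearMap.comp_smul, hD', TensorProduct.map_smul_right, LinearMap.smul_comp]

/-- Odd right-invariant superderivations: `Δ ∘ D = (D ⊗ id) ∘ Δ`. -/
def IsOddRightInvariant (D : A →ₗ[k] A) : Prop :=
  D ∈ oddSuperDer 𝒜 ∧ Coalgebra.comul ∘ₗ D = D.rTensor A ∘ₗ Coalgebra.comul

section quotient

variable [IsSuperCommutative 𝒜]

/-- `B = A / J`. -/
abbrev Bquot : Type _ := A ⧸ superRadical 𝒜

/-- The quotient map `π : A → B`. -/
def piMap : A →ₐ[k] Bquot 𝒜 := Ideal.Quotient.mkₐ k (superRadical 𝒜)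

/-- The `B`-comodule structure `(id ⊗ π) ∘ Δ : A → A ⊗ B` of `A`. -/
def coaction : A →ₗ[k] A ⊗[k] Bquot 𝒜 :=
  (piMap 𝒜).toLinearMap.lTensor A ∘ₗ Coalgebra.comul

/-- The invariants `A^G`, `G = Spec B`: all `v` with coaction `v ⊗ 1`. -/
def invariants : Submodule k A :=
  LinearMap.eqLocus (coaction 𝒜) ((TensorProduct.mk k A (Bquot 𝒜)).flip 1)

/-- The quotient map `A → A / J²` as a `k`-linear map. -/
def modSq : A →ₗ[k] A ⧸ (superRadical 𝒜 * superRadical 𝒜) :=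
  (Submodule.mkQ (superRadical 𝒜 * superRadical 𝒜)).restrictScalars k

/-- The invariants `(J/J²)^G` of the quotient comodule `J/J²`, as a subspace of `A/J²`: the classes
of all `x ∈ J` whose coaction, read in `(A/J²) ⊗ B`, is `[x] ⊗ 1`. -/
def invariantsJModSq : Submodule k (A ⧸ (superRadical 𝒜 * superRadical 𝒜)) :=
  ((superRadical 𝒜).restrictScalars k ⊓
    LinearMap.eqLocus ((modSq 𝒜).rTensor (Bquot 𝒜) ∘ₗ coaction 𝒜)
      ((TensorProduct.mk k (A ⧸ (superRadical 𝒜 * superRadical 𝒜)) (Bquot 𝒜)).flip 1 ∘ₗ modSq 𝒜)).map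
    (modSq 𝒜)

/-- Admissible choices: `θ₁, …, θₛ ∈ (J_-)^G` represent a `k`-basis of `(J/J²)^G`, and
`D'₁, …, D'ₛ` are odd right-invariant superderivations with `e(D'ᵢ θⱼ) = δᵢⱼ`, `e` the counit. -/
structure IsAdapted {s : ℕ} (θ : Fin s → A) (D' : Fin s → A →ₗ[k] A) : Prop where
  odd : ∀ i, θ i ∈ 𝒜 1
  invariant : ∀ i, θ i ∈ invariants 𝒜
  linearIndependent : LinearIndependent k (fun i => modSq 𝒜 (θ i))
  span_eq : Submodule.span k (Set.range fun i => modSq 𝒜 (θ i)) = invariantsJModSq 𝒜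
  rightInvariant : ∀ i, IsOddRightInvariant 𝒜 (D' i)
  dual : ∀ i j, Coalgebra.counit (R := k) (D' i (θ j)) = if i = j then 1 else 0

end quotient

end

/-- The Euler operator `D = ∑ θᵢ D'ᵢ`. -/
def eulerDerivation {A : Type*} [Ring A] [Algebra k A] {s : ℕ}
    (θ : Fin s → A) (D' : Fin s → A →ₗ[k] A) : A →ₗ[k] A :=
  ∑ i, LinearMap.mulLeft k (θ i) ∘ₗ D' i

/-- The superpolynomial ring `k[θ₁, …, θₛ]` in `s` odd variables, i.e. the exterior algebra. -/
abbrev SuperPoly (k : Type*) [Field k] (s : ℕ) : Type _ := ExteriorAlgebra k (Fin s → k)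

/-- The `ℤ/2`-grading of the superpolynomial ring, in which the variables are odd. -/
abbrev superPolyGrading (k : Type*) [Field k] (s : ℕ) : ZMod 2 → Submodule k (SuperPoly k s) :=
  CliffordAlgebra.evenOdd (0 : QuadraticForm k (Fin s → k))

/-- The variable `θᵢ` of the superpolynomial ring. -/
def superPolyVar (k : Type*) [Field k] {s : ℕ} (i : Fin s) : SuperPoly k s :=
  ExteriorAlgebra.ι k (Pi.single i 1)

end SuperHopf

end

open SuperHopf

/-! Finitely many odd elements generate `J`, so `J` is nilpotent, and a linear section of `π` can be
corrected to a colinear map `φ : B → A` with `φ 1 = 1`, each correction raising the power of `J` in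
which colinearity fails. Averaging `a ↦ ∑ a₀ φ(S(a₁))` lifts the invariants of `J/J²` to odd
elements `θᵢ` of `A^G`, which generate `J`; the dual `D'ᵢ` are the operators `(δᵢ ⊗ id) ∘ Δ` of odd
derivations `δᵢ : A → k` at the counit, which form a space isomorphic to `𝔤_-` and dual to
`(J/J²)^G`.

The Euler operator `D` acts on `J^n / J^(n+1)` as multiplication by `n`, which is invertible in `k`
for `0 < n ≤ s`, while `J^(s+1) = 0`. Hence `A = ker D ⊕ J`, so `π` maps `ker D` isomorphically onto
`B`. The inverse is a multiplicative `φ`, and a comodule algebra with such a splitting is the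
product of its invariants and the image of the splitting. Applied to polynomials in `θ`, the `D'ᵢ`
agree to leading order with the formal derivatives, whose Euler operator counts degrees, so a
nonzero polynomial cannot vanish at `θ`. Conversely the average of `v a`, for a monomial `v` in `θ`,
is a multiple of `v` to leading order, and so `θ` generates `A^G`. -/

noncomputable section

namespace SuperHopf

section AdicFiltration

variable {k A : Type*} [CommSemiring k] [Semiring A] [Algebra k A] {V W : Submodule k A} {m n : ℕ}

/-- The subspaces `V ^ n * A`. When `V * A = A * V` these are the powers of the ideal generated by
`V`; unlike `V ^ n` this reads `A` for `n = 0`. -/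
def adicFiltration (V : Submodule k A) (n : ℕ) : Submodule k A := V ^ n * ⊤

lemma adicFiltration_zero : adicFiltration V 0 = ⊤ := by
  rw [adicFiltration, pow_zero, one_mul]

lemma adicFiltration_one : adicFiltration V 1 = V * ⊤ := by
  rw [adicFiltration, pow_one]

lemma adicFiltration_succ (n : ℕ) : adicFiltration V (n + 1) = V * adicFiltration V n := by
  rw [adicFiltration, pow_succ', mul_assoc, adicFiltration]

lemma top_mul_top : (⊤ : Submodule k A) * ⊤ = ⊤ :=
  top_le_iff.1 fun x _ => by
    simpa using Submodule.mul_mem_mul (Submodule.mem_top (R := k) (x := x))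
      (Submodule.mem_top (R := k) (x := (1 : A)))

lemma adicFiltration_mul_top (n : ℕ) : adicFiltration V n * ⊤ = adicFiltration V n := by
  rw [adicFiltration, mul_assoc, top_mul_top]

lemma mul_mem_adicFiltration_right {a : A} (ha : a ∈ adicFiltration V n) (b : A) :
    a * b ∈ adicFiltration V n := by
  rw [← adicFiltration_mul_top]
  exact Submodule.mul_mem_mul ha Submodule.mem_top

lemma pow_le_adicFiltration : V ^ n ≤ adicFiltration V n := fun x hx => by
  simpa [adicFiltration] using Submodule.mul_mem_mul hx (Submodule.mem_top (R := k) (x := (1 : A)))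

lemma le_adicFiltration_one : V ≤ adicFiltration V 1 :=
  (pow_one V).ge.trans pow_le_adicFiltration

lemma adicFiltration_mul (hV : Commute V ⊤) (m n : ℕ) :
    adicFiltration V m * adicFiltration V n = adicFiltration V (m + n) := by
  rw [adicFiltration, adicFiltration, adicFiltration, mul_assoc, ← mul_assoc ⊤,
    (hV.symm.pow_right n).eq, mul_assoc, top_mul_top, ← mul_assoc, pow_add]

lemma mul_mem_adicFiltration (hV : Commute V ⊤) {a b : A} (ha : a ∈ adicFiltration V m)
    (hb : b ∈ adicFiltration V n) : a * b ∈ adicFiltration V (m + n) :=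
  adicFiltration_mul hV m n ▸ Submodule.mul_mem_mul ha hb

lemma mul_mem_adicFiltration_left (hV : Commute V ⊤) (a : A) {b : A}
    (hb : b ∈ adicFiltration V n) : a * b ∈ adicFiltration V n := by
  simpa using mul_mem_adicFiltration hV (m := 0) (a := a) (by simp [adicFiltration_zero]) hb

lemma adicFiltration_antitone (hV : Commute V ⊤) : Antitone (adicFiltration V) :=
  antitone_nat_of_succ_le fun n => by
    rw [adicFiltration_succ]
    exact Submodule.mul_le.2 fun a _ b hb => mul_mem_adicFiltration_left hV a hb

lemma adicFiltration_eq_of_one_eq (hV : Commute V ⊤) (hW : Commute W ⊤)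
    (h : adicFiltration V 1 = adicFiltration W 1) (n : ℕ) :
    adicFiltration V n = adicFiltration W n := by
  induction n with
  | zero => rw [adicFiltration_zero, adicFiltration_zero]
  | succ n ih => rw [← adicFiltration_mul hV, ← adicFiltration_mul hW, ih, h]

/-- Nakayama's lemma for a nilpotent ideal. -/
lemma adicFiltration_one_le_of_le_sup (hV : Commute V ⊤) (hn : adicFiltration V n = ⊥)
    (h : adicFiltration V 1 ≤ W * ⊤ ⊔ adicFiltration V 2) : adicFiltration V 1 ≤ W * ⊤ := by
  have hstep (m : ℕ) : adicFiltration V 1 ≤ W * ⊤ ⊔ adicFiltration V (m + 1) := by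
    induction m with
    | zero => exact le_sup_right
    | succ m ih =>
      refine ih.trans (sup_le le_sup_left ?_)
      calc adicFiltration V (m + 1) = adicFiltration V 1 * adicFiltration V m := by
            rw [adicFiltration_mul hV, add_comm]
        _ ≤ (W * ⊤ ⊔ adicFiltration V 2) * adicFiltration V m := by gcongr
        _ = W * (⊤ * adicFiltration V m) ⊔ adicFiltration V (m + 2) := by
            rw [Submodule.sup_mul, mul_assoc, adicFiltration_mul hV, add_comm]
        _ ≤ W * ⊤ ⊔ adicFiltration V (m + 2) := by gcongr; exact le_top
  have hbot : adicFiltration V (n + 1) ≤ ⊥ := hn ▸ adicFiltration_antitone hV n.le_succ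
  exact (hstep n).trans (sup_le le_rfl (hbot.trans bot_le))

end AdicFiltration

section Euler

variable {k M : Type*} [Field k] [AddCommGroup M] [Module k M] {F : ℕ → Submodule k M}
  {D : M →ₗ[k] M} {N : ℕ}

lemma disjoint_ker_of_apply_sub_smul_mem (hN : F (N + 1) = ⊥)
    (hD : ∀ n, ∀ a ∈ F n, D a - (n : k) • a ∈ F (n + 1))
    (hk : ∀ n, 0 < n → n ≤ N → (n : k) ≠ 0) : Disjoint (LinearMap.ker D) (F 1) := by
  refine Submodule.disjoint_def.2 fun a ha ha1 => ?_
  have hmem (n : ℕ) (hn : n ≤ N) : a ∈ F (n + 1) := by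
    induction n with
    | zero => exact ha1
    | succ n ih =>
      have h := hD (n + 1) a (ih (Nat.le_of_succ_le hn))
      rw [LinearMap.mem_ker.1 ha, zero_sub, neg_mem_iff] at h
      exact (Submodule.smul_mem_iff _ (hk _ n.succ_pos hn)).1 h
  rw [← Submodule.mem_bot k, ← hN]
  exact hmem N le_rfl

lemma codisjoint_ker_of_apply_sub_smul_mem (h0 : F 0 = ⊤) (hN : F (N + 1) = ⊥)
    (hD : ∀ n, ∀ a ∈ F n, D a - (n : k) • a ∈ F (n + 1))
    (hk : ∀ n, 0 < n → n ≤ N → (n : k) ≠ 0) : Codisjoint (LinearMap.ker D) (F 1) := by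
  have hD1 (a : M) : D a ∈ F 1 := by simpa using hD 0 a (h0 ▸ Submodule.mem_top)
  -- Subtracting `(n + 1)⁻¹ • D b` from `b` kills the leading term of `D b ∈ F (n + 1)`.
  have happrox (a : M) (n : ℕ) (hn : n ≤ N) : ∃ b, a - b ∈ F 1 ∧ D b ∈ F (n + 1) := by
    induction n with
    | zero => exact ⟨a, by simp, hD1 a⟩
    | succ n ih =>
      obtain ⟨b, hb, hDb⟩ := ih (Nat.le_of_succ_le hn)
      have hc := hk _ n.succ_pos hn
      refine ⟨b - ((n + 1 : ℕ) : k)⁻¹ • D b, ?_, ?_⟩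
      · rw [← sub_add]
        exact add_mem hb (Submodule.smul_mem _ _ (hD1 b))
      · convert Submodule.smul_mem _ (-((n + 1 : ℕ) : k)⁻¹) (hD _ _ hDb) using 1
        rw [map_sub, map_smul, smul_sub, smul_smul, neg_mul, inv_mul_cancel₀ hc, neg_smul, neg_smul,
          one_smul, neg_sub_neg]
  refine Submodule.codisjoint_iff_exists_add_eq.2 fun a => ?_
  obtain ⟨b, hb, hDb⟩ := happrox a N le_rfl
  rw [hN, Submodule.mem_bot] at hDb
  exact ⟨b, a - b, hDb, hb, add_sub_cancel b a⟩

end Euler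

section TensorTop

variable {k A H C : Type*} [CommRing k]

section Module

variable [AddCommGroup A] [Module k A] [AddCommGroup H] [Module k H] [AddCommGroup C] [Module k C]

variable (H) in
/-- The image of `V ⊗ H` in `A ⊗ H`. -/
def tensorTop (V : Submodule k A) : Submodule k (A ⊗[k] H) :=
  Submodule.map₂ (TensorProduct.mk k A H) V ⊤

variable {V W : Submodule k A} {u : A ⊗[k] H}

lemma tmul_mem_tensorTop {a : A} (ha : a ∈ V) (h : H) : a ⊗ₜ h ∈ tensorTop H V :=
  Submodule.apply_mem_map₂ _ ha Submodule.mem_top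

lemma tensorTop_le {P : Submodule k (A ⊗[k] H)} :
    tensorTop H V ≤ P ↔ ∀ a ∈ V, ∀ h : H, a ⊗ₜ h ∈ P := by
  simp [tensorTop, Submodule.map₂_le]

lemma tensorTop_top : tensorTop H (⊤ : Submodule k A) = ⊤ :=
  TensorProduct.map₂_mk_top_top_eq_top k A H

lemma tensorTop_bot : tensorTop H (⊥ : Submodule k A) = ⊥ :=
  Submodule.map₂_bot_left _ _

lemma tensorTop_mono (h : V ≤ W) : tensorTop H V ≤ tensorTop H W :=
  Submodule.map₂_le_map₂_left h

lemma lTensor_mem_tensorTop (hu : u ∈ tensorTop H V) (g : H →ₗ[k] C) :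
    g.lTensor A u ∈ tensorTop C V := by
  revert u
  change tensorTop H V ≤ (tensorTop C V).comap (g.lTensor A)
  exact tensorTop_le.2 fun a ha h => tmul_mem_tensorTop ha (g h)

lemma tensorTop_range (g : C →ₗ[k] A) :
    tensorTop H (LinearMap.range g) = LinearMap.range (g.rTensor H) := by
  refine le_antisymm (tensorTop_le.2 ?_) ?_
  · rintro _ ⟨c, rfl⟩ h
    exact ⟨c ⊗ₜ h, rfl⟩
  · rintro _ ⟨t, rfl⟩
    induction t with
    | zero => simp
    | add x y hx hy => simpa using add_mem hx hy
    | tmul c h => exact tmul_mem_tensorTop (LinearMap.mem_range_self g c) h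

lemma tensorTop_ker [Module.Flat k H] (g : A →ₗ[k] C) :
    tensorTop H (LinearMap.ker g) = LinearMap.ker (g.rTensor H) := by
  rw [(Module.Flat.rTensor_exact H (LinearMap.exact_subtype_ker_map g)).linearMap_ker_eq,
    ← tensorTop_range, Submodule.range_subtype]

end Module

section Algebra

variable [Ring A] [Algebra k A] [Ring H] [Algebra k H] {V W : Submodule k A}

lemma tensorTop_mul_le : tensorTop H V * tensorTop H W ≤ tensorTop H (V * W) := by
  rw [tensorTop, tensorTop, Submodule.map₂_eq_span_image2, Submodule.map₂_eq_span_image2,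
    Submodule.span_mul_span, Submodule.span_le]
  rintro _ ⟨_, ⟨a, ha, h, -, rfl⟩, _, ⟨b, hb, h', -, rfl⟩, rfl⟩
  simpa using tmul_mem_tensorTop (Submodule.mul_mem_mul ha hb) (h * h')

lemma mul_mem_tensorTop {u v : A ⊗[k] H} (hu : u ∈ tensorTop H V) (hv : v ∈ tensorTop H W) :
    u * v ∈ tensorTop H (V * W) :=
  tensorTop_mul_le (Submodule.mul_mem_mul hu hv)

lemma mul_includeRight_mem_tensorTop {u : A ⊗[k] H} (hu : u ∈ tensorTop H V) (h : H) :
    u * 1 ⊗ₜ h ∈ tensorTop H V := by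
  simpa using mul_mem_tensorTop hu (tmul_mem_tensorTop (Submodule.one_le.1 le_rfl) h)

end Algebra

end TensorTop

section Comodule

open Coalgebra

variable {k M N P H : Type*} [CommRing k]
  [AddCommGroup M] [Module k M] [AddCommGroup N] [Module k N] [AddCommGroup P] [Module k P]
  [AddCommGroup H] [Module k H]

/-- The failure `(f ⊗ id) ∘ ρ - ρ' ∘ f` of a linear map `f` to be colinear for the coactions `ρ` and
`ρ'`. -/
def colinearDefect (ρ : M →ₗ[k] M ⊗[k] H) (ρ' : N →ₗ[k] N ⊗[k] H) (f : M →ₗ[k] N) :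
    M →ₗ[k] N ⊗[k] H :=
  f.rTensor H ∘ₗ ρ - ρ' ∘ₗ f

lemma colinearDefect_comp (ρ : M →ₗ[k] M ⊗[k] H) (ρ' : N →ₗ[k] N ⊗[k] H) (ρ'' : P →ₗ[k] P ⊗[k] H)
    (g : N →ₗ[k] P) (f : M →ₗ[k] N) :
    colinearDefect ρ ρ'' (g ∘ₗ f) =
      g.rTensor H ∘ₗ colinearDefect ρ ρ' f + colinearDefect ρ' ρ'' g ∘ₗ f := by
  simp only [colinearDefect, LinearMap.rTensor_comp, LinearMap.comp_sub, LinearMap.sub_comp,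
    LinearMap.comp_assoc]
  abel

variable [Coalgebra k H]

variable (k M H) in
/-- The coaction of `H` on `M ⊗ H` through the second factor. -/
def cofreeCoaction : M ⊗[k] H →ₗ[k] (M ⊗[k] H) ⊗[k] H :=
  (TensorProduct.assoc k M H H).symm.toLinearMap ∘ₗ comul.lTensor M

lemma colinearDefect_rTensor_comul (φ : H →ₗ[k] M) :
    colinearDefect comul (cofreeCoaction k M H) (φ.rTensor H ∘ₗ comul) = 0 := by
  have hcomm (t : H ⊗[k] H) : comul.lTensor M (φ.rTensor H t) =
      φ.rTensor (H ⊗[k] H) (comul.lTensor H t) := by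
    rw [← LinearMap.comp_apply, ← LinearMap.comp_apply, LinearMap.lTensor_comp_rTensor,
      LinearMap.rTensor_comp_lTensor]
  have hassoc : (φ.rTensor H).rTensor H = (TensorProduct.assoc k M H H).symm.toLinearMap ∘ₗ
      φ.rTensor (H ⊗[k] H) ∘ₗ (TensorProduct.assoc k H H H).toLinearMap := by
    ext; simp
  ext h
  simp [colinearDefect, cofreeCoaction, hcomm, hassoc, LinearMap.rTensor_comp]

end Comodule

section ComoduleAlgebra

open Coalgebra WithConv

variable {k A H : Type*} [CommRing k] [Ring A] [Algebra k A] [Ring H]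

/-- A coaction `ρ : A → A ⊗ H` of a bialgebra `H` on an algebra `A` by algebra homomorphisms. -/
structure IsComoduleAlgebra [Bialgebra k H] (ρ : A →ₐ[k] A ⊗[k] H) : Prop where
  coassoc : ∀ a, TensorProduct.assoc k A H H (ρ.toLinearMap.rTensor H (ρ a)) =
    comul.lTensor A (ρ a)
  lTensor_counit : ∀ a, counit.lTensor A (ρ a) = a ⊗ₜ 1

section Basic

variable [Algebra k H] (ρ : A →ₐ[k] A ⊗[k] H)

/-- The subalgebra of all `a` with `ρ a = a ⊗ 1`. -/
def coinvariants : Subalgebra k A :=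
  AlgHom.equalizer ρ Algebra.TensorProduct.includeLeft

/-- The subspace `V` is stable under the coaction: `ρ(V) ⊆ V ⊗ H`. -/
def IsSubcomodule (V : Submodule k A) : Prop :=
  ∀ a ∈ V, ρ a ∈ tensorTop H V

variable {ρ} {V W : Submodule k A}

lemma mem_coinvariants {a : A} : a ∈ coinvariants ρ ↔ ρ a = a ⊗ₜ 1 := Iff.rfl

lemma IsSubcomodule.mul (hV : IsSubcomodule ρ V) (hW : IsSubcomodule ρ W) :
    IsSubcomodule ρ (V * W) := fun a ha => by
  induction ha using Submodule.mul_induction_on' with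
  | mem_mul_mem v hv w hw => rw [map_mul]; exact mul_mem_tensorTop (hV v hv) (hW w hw)
  | add x _ y _ hx hy => rw [map_add]; exact add_mem hx hy

lemma isSubcomodule_top : IsSubcomodule ρ ⊤ := fun _ _ => by
  rw [tensorTop_top]; exact Submodule.mem_top

lemma isSubcomodule_adicFiltration (hV : Commute V ⊤) (h1 : IsSubcomodule ρ (adicFiltration V 1))
    (n : ℕ) : IsSubcomodule ρ (adicFiltration V n) := by
  induction n with
  | zero => rw [adicFiltration_zero]; exact isSubcomodule_top
  | succ n ih => rw [← adicFiltration_mul hV]; exact ih.mul h1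

lemma isSubcomodule_ker_of_colinear [Module.Flat k H] {D : A →ₗ[k] A}
    (hD : ∀ a, ρ (D a) = D.rTensor H (ρ a)) : IsSubcomodule ρ (LinearMap.ker D) := fun a ha => by
  rw [tensorTop_ker, LinearMap.mem_ker, ← hD, LinearMap.mem_ker.1 ha, map_zero]

end Basic

section Convolution

section Algebra

variable [Algebra k H] (ρ : A →ₐ[k] A ⊗[k] H)

/-- The map `a ⊗ h ↦ (id ⊗ ψ)(ρ a) (1 ⊗ h)`. For a comodule algebra this is an action on `A ⊗ H` of
the convolution algebra of linear endomorphisms of `H`; the identity of `H` acts as the canonical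
(Galois) map `a ⊗ h ↦ ρ(a) (1 ⊗ h)`. -/
def convAction (ψ : WithConv (H →ₗ[k] H)) : A ⊗[k] H →ₗ[k] A ⊗[k] H :=
  LinearMap.mul' k (A ⊗[k] H) ∘ₗ TensorProduct.map (ψ.ofConv.lTensor A ∘ₗ ρ.toLinearMap)
    (Algebra.TensorProduct.includeRight : H →ₐ[k] A ⊗[k] H).toLinearMap

variable {ρ} (ψ : WithConv (H →ₗ[k] H))

lemma convAction_tmul (a : A) (h : H) :
    convAction ρ ψ (a ⊗ₜ h) = ψ.ofConv.lTensor A (ρ a) * 1 ⊗ₜ h := rfl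

lemma convAction_mul_includeRight (u : A ⊗[k] H) (h : H) :
    convAction ρ ψ (u * 1 ⊗ₜ h) = convAction ρ ψ u * 1 ⊗ₜ h := by
  induction u with
  | zero => simp
  | add x y hx hy => simp only [add_mul, map_add, hx, hy]
  | tmul a b => simp [convAction_tmul, mul_assoc]

lemma convAction_apply (u : A ⊗[k] H) :
    convAction ρ ψ u = (LinearMap.mul' k H ∘ₗ ψ.ofConv.rTensor H).lTensor A
      (TensorProduct.assoc k A H H (ρ.toLinearMap.rTensor H u)) := by
  induction u with
  | zero => simp
  | add x y hx hy => simp only [map_add, hx, hy]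
  | tmul a b =>
    rw [convAction_tmul, LinearMap.rTensor_tmul, AlgHom.toLinearMap_apply]
    induction ρ a with
    | zero => simp
    | add x y hx hy => simp only [map_add, add_mul, TensorProduct.add_tmul, hx, hy]
    | tmul x c => simp

lemma IsSubcomodule.convAction_mem {V : Submodule k A} (hV : IsSubcomodule ρ V)
    {u : A ⊗[k] H} (hu : u ∈ tensorTop H V) : convAction ρ ψ u ∈ tensorTop H V := by
  revert u
  change tensorTop H V ≤ (tensorTop H V).comap (convAction ρ ψ)
  exact tensorTop_le.2 fun a ha h =>
    mul_includeRight_mem_tensorTop (lTensor_mem_tensorTop (hV a ha) _) h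

end Algebra

namespace IsComoduleAlgebra

variable [Bialgebra k H] {ρ : A →ₐ[k] A ⊗[k] H} (ψ χ : WithConv (H →ₗ[k] H))
  (hρ : IsComoduleAlgebra ρ)
include hρ

lemma convAction_lTensor (a : A) :
    convAction ρ ψ (χ.ofConv.lTensor A (ρ a)) = (ψ * χ).ofConv.lTensor A (ρ a) := by
  have hcomm : TensorProduct.assoc k A H H (ρ.toLinearMap.rTensor H (χ.ofConv.lTensor A (ρ a))) =
      (χ.ofConv.lTensor H).lTensor A (comul.lTensor A (ρ a)) := by
    rw [← hρ.coassoc]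
    induction ρ a with
    | zero => simp
    | add x y hx hy => simp only [map_add, hx, hy]
    | tmul x c =>
      simp only [LinearMap.lTensor_tmul, LinearMap.rTensor_tmul, AlgHom.toLinearMap_apply]
      induction ρ x with
      | zero => simp
      | add x y hx hy => simp only [map_add, TensorProduct.add_tmul, hx, hy]
      | tmul y d => simp
  have hconv : (LinearMap.mul' k H ∘ₗ ψ.ofConv.rTensor H) ∘ₗ χ.ofConv.lTensor H ∘ₗ comul =
      (ψ * χ).ofConv := by
    rw [LinearMap.convMul_def, ← LinearMap.rTensor_comp_lTensor]
    rfl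
  simp only [convAction_apply, hcomm, ← hconv, LinearMap.lTensor_comp, LinearMap.comp_apply]

lemma convAction_mul : convAction ρ (ψ * χ) = convAction ρ ψ ∘ₗ convAction ρ χ := by
  ext a h
  simp [convAction_tmul, convAction_mul_includeRight, hρ.convAction_lTensor]

lemma convAction_one : convAction ρ 1 = LinearMap.id := by
  ext a h
  have hone : (1 : WithConv (H →ₗ[k] H)).ofConv.lTensor A (ρ a) = a ⊗ₜ 1 := by
    rw [LinearMap.convOne_def, LinearMap.lTensor_comp, LinearMap.comp_apply,
      hρ.lTensor_counit]
    simp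
  simp [convAction_tmul, hone]

end IsComoduleAlgebra

end Convolution

end ComoduleAlgebra

section TotalIntegral

open Coalgebra WithConv

variable {k A H : Type*} [CommRing k] [Ring A] [Algebra k A] [Ring H] [HopfAlgebra k H]
  {ρ : A →ₐ[k] A ⊗[k] H} {V : Submodule k A}

lemma IsComoduleAlgebra.convAction_antipode (hρ : IsComoduleAlgebra ρ) (a : A) (h : H) :
    convAction ρ (toConv (HopfAlgebra.antipode k)) (ρ a * 1 ⊗ₜ h) = a ⊗ₜ h := by
  have := LinearMap.congr_fun (hρ.convAction_mul (toConv (HopfAlgebra.antipode k))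
    (toConv LinearMap.id)) (a ⊗ₜ h)
  rw [LinearMap.antipode_mul_id, hρ.convAction_one] at this
  simpa [convAction_tmul] using this.symm

/-- This is the surjectivity of the canonical map `a ⊗ h ↦ ρ(a) (1 ⊗ h)`, restricted to `V ⊗ H`. -/
lemma IsComoduleAlgebra.tensorTop_le_of_coaction (hρ : IsComoduleAlgebra ρ)
    (hV : IsSubcomodule ρ V) {P : Submodule k (A ⊗[k] H)}
    (hP : ∀ a ∈ V, ∀ h : H, ρ a * 1 ⊗ₜ h ∈ P) : tensorTop H V ≤ P := fun u hu => by
  have hinv := LinearMap.congr_fun (hρ.convAction_mul (toConv LinearMap.id)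
    (toConv (HopfAlgebra.antipode k))) u
  rw [LinearMap.id_mul_antipode, hρ.convAction_one, LinearMap.id_apply] at hinv
  have hle : tensorTop H V ≤ P.comap (convAction ρ (toConv LinearMap.id)) :=
    tensorTop_le.2 fun a ha h => by simpa [convAction_tmul] using hP a ha h
  rw [hinv]
  exact hle (hV.convAction_mem (toConv (HopfAlgebra.antipode k)) hu)

variable (ρ) in
/-- The map `a ⊗ h ↦ ∑ a₀ φ(S(a₁) h)`, a left inverse of the coaction `ρ a = ∑ a₀ ⊗ a₁` when
`φ 1 = 1`. -/
def retract (φ : H →ₗ[k] A) : A ⊗[k] H →ₗ[k] A :=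
  LinearMap.mul' k A ∘ₗ φ.lTensor A ∘ₗ convAction ρ (toConv (HopfAlgebra.antipode k))

variable {φ : H →ₗ[k] A}

lemma retract_tmul (a : A) (h : H) : retract ρ φ (a ⊗ₜ h) =
    LinearMap.mul' k A (φ.lTensor A ((HopfAlgebra.antipode k).lTensor A (ρ a) * 1 ⊗ₜ h)) := rfl

lemma IsComoduleAlgebra.retract_mul_includeRight (hρ : IsComoduleAlgebra ρ) (a : A) (h : H) :
    retract ρ φ (ρ a * 1 ⊗ₜ h) = a * φ h := by
  rw [retract, LinearMap.comp_apply, LinearMap.comp_apply, hρ.convAction_antipode]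
  simp

lemma IsComoduleAlgebra.retract_comp_coaction (hρ : IsComoduleAlgebra ρ) (hφ : φ 1 = 1) :
    retract ρ φ ∘ₗ ρ.toLinearMap = LinearMap.id := by
  ext a
  simpa [hφ, ← Algebra.TensorProduct.one_def] using hρ.retract_mul_includeRight (φ := φ) a 1

lemma IsComoduleAlgebra.retract_coaction (hρ : IsComoduleAlgebra ρ) (hφ : φ 1 = 1) (a : A) :
    retract ρ φ (ρ a) = a :=
  LinearMap.congr_fun (hρ.retract_comp_coaction hφ) a

lemma IsSubcomodule.retract_mem (hV : IsSubcomodule ρ V) (hmul : V * ⊤ ≤ V) {u : A ⊗[k] H}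
    (hu : u ∈ tensorTop H V) : retract ρ φ u ∈ V := by
  have hle : tensorTop H V ≤ V.comap (LinearMap.mul' k A ∘ₗ φ.lTensor A) :=
    tensorTop_le.2 fun a ha h => hmul (Submodule.mul_mem_mul ha Submodule.mem_top)
  exact hle (hV.convAction_mem _ hu)

lemma IsComoduleAlgebra.colinearDefect_coaction (hρ : IsComoduleAlgebra ρ) :
    colinearDefect ρ.toLinearMap (cofreeCoaction k A H) ρ.toLinearMap = 0 := by
  ext a
  simp [colinearDefect, cofreeCoaction, ← hρ.coassoc]

lemma IsComoduleAlgebra.colinearDefect_retract (hρ : IsComoduleAlgebra ρ) (a : A) (h : H) :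
    colinearDefect (cofreeCoaction k A H) ρ.toLinearMap (retract ρ φ) (ρ a * 1 ⊗ₜ h) =
      ρ a * colinearDefect comul ρ.toLinearMap φ h := by
  have hcomul (t : A ⊗[k] H) : comul.lTensor A (t * (1 ⊗ₜ h)) =
      comul.lTensor A t * (1 ⊗ₜ comul h) := by
    induction t with
    | zero => simp
    | add x y hx hy => simp only [map_add, add_mul, hx, hy]
    | tmul a c => simp
  have hsymm (x y : A ⊗[k] (H ⊗[k] H)) : (TensorProduct.assoc k A H H).symm (x * y) =
      (TensorProduct.assoc k A H H).symm x * (TensorProduct.assoc k A H H).symm y :=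
    map_mul (Algebra.TensorProduct.assoc k k k A H H).symm x y
  have hretract (t : A ⊗[k] H) (w : H ⊗[k] H) : (retract ρ φ).rTensor H
      (ρ.toLinearMap.rTensor H t * (TensorProduct.assoc k A H H).symm (1 ⊗ₜ w)) =
        t * φ.rTensor H w := by
    induction t with
    | zero => simp
    | add x y hx hy => simp only [map_add, add_mul, hx, hy]
    | tmul a c =>
    induction w with
    | zero => simp
    | add x y hx hy => simp only [map_add, mul_add, TensorProduct.tmul_add, hx, hy]
    | tmul b d => simp [hρ.retract_mul_includeRight]
  simp [colinearDefect, cofreeCoaction, hcomul, hsymm, ← hρ.coassoc, hretract,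
    hρ.retract_mul_includeRight, mul_sub]

end TotalIntegral

section ExistsTotalIntegral

open Coalgebra

variable {k A H : Type*} [CommRing k] [Ring A] [Algebra k A] [Ring H] [HopfAlgebra k H]
  {ρ : A →ₐ[k] A ⊗[k] H} {φ : H →ₗ[k] A} {V : Submodule k A}

/-- A total integral in the sense of Doi: a unital map `H → A` that is colinear for the regular
coaction on `H`. -/
structure IsTotalIntegral (ρ : A →ₐ[k] A ⊗[k] H) (φ : H →ₗ[k] A) : Prop where
  colinearDefect_eq_zero : colinearDefect comul ρ.toLinearMap φ = 0
  map_one : φ 1 = 1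

lemma IsComoduleAlgebra.colinearDefect_retract_comp_coaction (hρ : IsComoduleAlgebra ρ)
    (hφ : φ 1 = 1) :
    colinearDefect (cofreeCoaction k A H) ρ.toLinearMap (retract ρ φ) ∘ₗ ρ.toLinearMap = 0 := by
  have h := colinearDefect_comp ρ.toLinearMap (cofreeCoaction k A H) ρ.toLinearMap
    (retract ρ φ) ρ.toLinearMap
  rw [hρ.retract_comp_coaction hφ, hρ.colinearDefect_coaction, LinearMap.comp_zero, zero_add] at h
  rw [← h]
  simp [colinearDefect]

/-- Composing `φ ⊗ id : H → A ⊗ H`, which is colinear, with the retraction of `ρ` built from `φ`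
squares the defect. -/
lemma IsComoduleAlgebra.colinearDefect_retract_comp_rTensor_comul (hρ : IsComoduleAlgebra ρ)
    (hφ : φ 1 = 1) :
    colinearDefect comul ρ.toLinearMap (retract ρ φ ∘ₗ φ.rTensor H ∘ₗ comul) =
      colinearDefect (cofreeCoaction k A H) ρ.toLinearMap (retract ρ φ) ∘ₗ
        colinearDefect comul ρ.toLinearMap φ := by
  rw [colinearDefect_comp comul (cofreeCoaction k A H), colinearDefect_rTensor_comul,
    LinearMap.comp_zero, zero_add, colinearDefect.eq_1 comul ρ.toLinearMap φ, LinearMap.comp_sub,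
    ← LinearMap.comp_assoc _ ρ.toLinearMap, hρ.colinearDefect_retract_comp_coaction hφ,
    LinearMap.zero_comp, sub_zero]

lemma IsComoduleAlgebra.retract_rTensor_comul (hρ : IsComoduleAlgebra ρ) (hφ : φ 1 = 1) (b : H) :
    retract ρ φ (φ.rTensor H (comul b)) =
      φ b + retract ρ φ (colinearDefect comul ρ.toLinearMap φ b) := by
  simp [colinearDefect, hρ.retract_coaction hφ]

lemma IsComoduleAlgebra.retract_rTensor_comul_one (hρ : IsComoduleAlgebra ρ) (hφ : φ 1 = 1) :
    retract ρ φ (φ.rTensor H (comul 1)) = 1 := by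
  have hone := hρ.retract_coaction hφ 1
  rw [map_one, Algebra.TensorProduct.one_def] at hone
  simp [Bialgebra.comul_one, Algebra.TensorProduct.one_def, hφ, hone]

lemma IsComoduleAlgebra.colinearDefect_retract_mem (hρ : IsComoduleAlgebra ρ)
    {W : Submodule k A} (hV : IsSubcomodule ρ V)
    (hφ : ∀ b, colinearDefect comul ρ.toLinearMap φ b ∈ tensorTop H W) {u : A ⊗[k] H}
    (hu : u ∈ tensorTop H V) :
    colinearDefect (cofreeCoaction k A H) ρ.toLinearMap (retract ρ φ) u ∈ tensorTop H (V * W) := by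
  revert u
  change tensorTop H V ≤ (tensorTop H (V * W)).comap _
  refine hρ.tensorTop_le_of_coaction hV fun a ha h => ?_
  rw [Submodule.mem_comap, hρ.colinearDefect_retract]
  exact mul_mem_tensorTop (hV a ha) (hφ h)

variable {π : A →ₐ[k] H}

lemma isSubcomodule_ker [Module.Flat k H]
    (hcoact : ∀ a, π.toLinearMap.rTensor H (ρ a) = comul (π a)) :
    IsSubcomodule ρ (LinearMap.ker π.toLinearMap) := fun a ha => by
  rw [tensorTop_ker, LinearMap.mem_ker, hcoact, show π a = 0 from ha, map_zero]

lemma isTotalIntegral_of_isSubcomodule_range (hφ : φ 1 = 1) (hπφ : ∀ b, π (φ b) = b)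
    (hcoact : ∀ a, π.toLinearMap.rTensor H (ρ a) = comul (π a))
    (h : IsSubcomodule ρ (LinearMap.range φ)) : IsTotalIntegral ρ φ where
  map_one := hφ
  colinearDefect_eq_zero := LinearMap.ext fun b => by
    obtain ⟨t, ht⟩ := (tensorTop_range φ).le (h (φ b) (LinearMap.mem_range_self φ b))
    have hcomp : π.toLinearMap ∘ₗ φ = LinearMap.id := LinearMap.ext hπφ
    have htb : t = comul b := by
      rw [← hπφ b, ← hcoact, ← ht, ← LinearMap.rTensor_comp_apply, hcomp, LinearMap.rTensor_id,
        LinearMap.id_apply]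
    simp [colinearDefect, ← ht, htb]

lemma exists_unital_linear_section [Module.Projective k H] (hπ : Function.Surjective π) :
    ∃ φ : H →ₗ[k] A, φ 1 = 1 ∧ ∀ b, π (φ b) = b := by
  obtain ⟨ψ, hψ⟩ := Module.projective_lifting_property π.toLinearMap LinearMap.id hπ
  replace hψ (b : H) : π (ψ b) = b := LinearMap.congr_fun hψ b
  exact ⟨ψ + counit.smulRight (1 - ψ 1), by simp, fun b => by simp [hψ]⟩

lemma rTensor_colinearDefect_of_section (hπφ : ∀ b, π (φ b) = b)
    (hcoact : ∀ a, π.toLinearMap.rTensor H (ρ a) = comul (π a)) (b : H) :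
    π.toLinearMap.rTensor H (colinearDefect comul ρ.toLinearMap φ b) = 0 := by
  have hcomp : π.toLinearMap ∘ₗ φ = LinearMap.id := LinearMap.ext hπφ
  rw [colinearDefect, LinearMap.sub_apply, LinearMap.comp_apply, map_sub,
    ← LinearMap.rTensor_comp_apply, hcomp]
  simp [hcoact, hπφ]

/-- A linear section of `π` is colinear up to `F 1 = ker π`. Correcting it as in
`colinearDefect_retract_comp_rTensor_comul` doubles the exponent, without changing the section
modulo `F 1`. -/
theorem exists_totalIntegral [Module.Projective k H] (hρ : IsComoduleAlgebra ρ)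
    (hπ : Function.Surjective π) (hcoact : ∀ a, π.toLinearMap.rTensor H (ρ a) = comul (π a))
    (hV : Commute V ⊤) (hker : LinearMap.ker π.toLinearMap = adicFiltration V 1) {N : ℕ}
    (hN : adicFiltration V N = ⊥) :
    ∃ φ : H →ₗ[k] A, IsTotalIntegral ρ φ ∧ ∀ b, π (φ b) = b := by
  have hsub := isSubcomodule_adicFiltration hV (hker ▸ isSubcomodule_ker hcoact)
  have happrox (n : ℕ) : ∃ φ : H →ₗ[k] A, φ 1 = 1 ∧ (∀ b, π (φ b) = b) ∧
      ∀ b, colinearDefect comul ρ.toLinearMap φ b ∈ tensorTop H (adicFiltration V (n + 1)) := by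
    induction n with
    | zero =>
      obtain ⟨φ, hφ1, hφ⟩ := exists_unital_linear_section hπ
      refine ⟨φ, hφ1, hφ, fun b => ?_⟩
      rw [zero_add, ← hker, tensorTop_ker]
      exact rTensor_colinearDefect_of_section hφ hcoact b
    | succ n ih =>
      obtain ⟨φ, hφ1, hφ, hdefect⟩ := ih
      refine ⟨retract ρ φ ∘ₗ φ.rTensor H ∘ₗ comul, hρ.retract_rTensor_comul_one hφ1, fun b => ?_,
        fun b => ?_⟩
      · have hmem := (hsub (n + 1)).retract_mem (φ := φ) (Submodule.mul_le.2 fun a ha c _ =>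
          mul_mem_adicFiltration_right ha c) (hdefect b)
        have hle : adicFiltration V (n + 1) ≤ LinearMap.ker π.toLinearMap :=
          hker ▸ adicFiltration_antitone hV (Nat.le_add_left 1 n)
        have hzero : π (retract ρ φ (colinearDefect comul ρ.toLinearMap φ b)) = 0 := hle hmem
        rw [LinearMap.comp_apply, LinearMap.comp_apply, hρ.retract_rTensor_comul hφ1, map_add,
          hzero, add_zero, hφ]
      · rw [hρ.colinearDefect_retract_comp_rTensor_comul hφ1]
        have hmem := hρ.colinearDefect_retract_mem (hsub (n + 1)) hdefect (hdefect b)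
        rw [adicFiltration_mul hV] at hmem
        exact tensorTop_mono (adicFiltration_antitone hV (by omega)) hmem
  obtain ⟨φ, hφ1, hφ, hdefect⟩ := happrox N
  refine ⟨φ, ⟨LinearMap.ext fun b => ?_, hφ1⟩, hφ⟩
  have hmem := tensorTop_mono (adicFiltration_antitone hV N.le_succ) (hdefect b)
  rwa [hN, tensorTop_bot, Submodule.mem_bot] at hmem

end ExistsTotalIntegral

section Average

open Coalgebra

variable {k A H C : Type*} [CommRing k] [Ring A] [Algebra k A] [Ring H] [HopfAlgebra k H]
  [Ring C] [Algebra k C] {ρ : A →ₐ[k] A ⊗[k] H} {φ : H →ₗ[k] A} {V I Θ : Submodule k A}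

lemma retract_coinvariant_mul {v : A} (hv : v ∈ coinvariants ρ) (u : A ⊗[k] H) :
    retract ρ φ (v ⊗ₜ 1 * u) = v * retract ρ φ u := by
  induction u with
  | zero => simp
  | add x y hx hy => simp only [mul_add, map_add, hx, hy]
  | tmul a h =>
    rw [Algebra.TensorProduct.tmul_mul_tmul, one_mul, retract_tmul, retract_tmul, map_mul ρ,
      mem_coinvariants.1 hv]
    induction ρ a with
    | zero => simp
    | add x y hx hy => simp only [mul_add, add_mul, map_add, hx, hy]
    | tmul x c => simp [mul_assoc]

variable (ρ φ) in
/-- The averaging (Reynolds type) operator `a ↦ ∑ a₀ φ(S(a₁))` onto the coinvariants. -/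
def average : A →ₗ[k] A := retract ρ φ ∘ₗ (TensorProduct.mk k A H).flip 1

lemma average_apply (a : A) : average ρ φ a = retract ρ φ (a ⊗ₜ 1) := rfl

lemma average_coinvariant_mul {v : A} (hv : v ∈ coinvariants ρ) (a : A) :
    average ρ φ (v * a) = v * average ρ φ a := by
  simpa [average_apply] using retract_coinvariant_mul (φ := φ) hv (a ⊗ₜ 1)

lemma IsSubcomodule.average_mem (hV : IsSubcomodule ρ V) (hmul : V * ⊤ ≤ V) {a : A}
    (ha : a ∈ V) : average ρ φ a ∈ V :=
  hV.retract_mem hmul (tmul_mem_tensorTop ha 1)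

lemma IsSubcomodule.retract_tmul_sub_mem (hV : IsSubcomodule ρ V)
    (hφ : ∀ b c, φ (b * c) - φ b * φ c ∈ I) {a : A} (ha : a ∈ V) (b : H) :
    retract ρ φ (a ⊗ₜ b) - average ρ φ a * φ b ∈ V * I := by
  have hle : tensorTop H V ≤ (V * I).comap
      (LinearMap.mul' k A ∘ₗ φ.lTensor A ∘ₗ LinearMap.mulRight k (1 ⊗ₜ b) -
        LinearMap.mulRight k (φ b) ∘ₗ LinearMap.mul' k A ∘ₗ φ.lTensor A) :=
    tensorTop_le.2 fun x hx c => by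
      simpa [mul_assoc, ← mul_sub] using Submodule.mul_mem_mul hx (hφ c b)
  rw [average_apply, retract_tmul, retract_tmul, ← Algebra.TensorProduct.one_def, mul_one]
  exact hle (lTensor_mem_tensorTop (hV a ha) _)

/-- Covers both the averages modulo `ker g` and, for `g = id`, those of the image of `φ`. -/
lemma map_average {g : A →ₐ[k] C} {τ : H →ₐ[k] C} (hτ : ∀ b, g (φ b) = τ b) {a : A} {h : H}
    (ha : g.toLinearMap.rTensor H (ρ a) = τ.toLinearMap.rTensor H (comul h)) :
    g (average ρ φ a) = algebraMap k C (counit h) := by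
  have hg (t : A ⊗[k] H) :
      g (LinearMap.mul' k A (φ.lTensor A ((HopfAlgebra.antipode k).lTensor A t))) =
        LinearMap.mul' k C (τ.toLinearMap.lTensor C
          ((HopfAlgebra.antipode k).lTensor C (g.toLinearMap.rTensor H t))) := by
    induction t with
    | zero => simp
    | add x y hx hy => simp only [map_add, hx, hy]
    | tmul x b => simp [hτ]
  have hmul (t : H ⊗[k] H) : LinearMap.mul' k C (τ.toLinearMap.lTensor C
      ((HopfAlgebra.antipode k).lTensor C (τ.toLinearMap.rTensor H t))) =
        τ (LinearMap.mul' k H ((HopfAlgebra.antipode k).lTensor H t)) := by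
    induction t with
    | zero => simp
    | add x y hx hy => simp only [map_add, hx, hy]
    | tmul x b => simp
  rw [average_apply, retract_tmul, ← Algebra.TensorProduct.one_def, mul_one, hg, ha, hmul,
    HopfAlgebra.mul_antipode_lTensor_comul_apply, AlgHom.commutes]

section TotalIntegral

variable (hρ : IsComoduleAlgebra ρ) (hφ : IsTotalIntegral ρ φ)
include hρ hφ

lemma average_of_mem_coinvariants {v : A} (hv : v ∈ coinvariants ρ) : average ρ φ v = v := by
  rw [average_apply, ← mem_coinvariants.1 hv, hρ.retract_coaction hφ.map_one]

lemma sub_average_mem (hV : IsSubcomodule ρ V) (hmul : V * ⊤ ≤ V) {a : A}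
    (ha : ρ a - a ⊗ₜ 1 ∈ tensorTop H V) : a - average ρ φ a ∈ V := by
  simpa [hρ.retract_coaction hφ.map_one, average_apply] using hV.retract_mem (φ := φ) hmul ha

lemma average_mem_coinvariants (a : A) : average ρ φ a ∈ coinvariants ρ := by
  have h := hρ.colinearDefect_retract_mem (W := ⊥) isSubcomodule_top
    (fun b => by rw [hφ.colinearDefect_eq_zero]; exact zero_mem _)
    (tensorTop_top (k := k) (A := A) (H := H) ▸ Submodule.mem_top (x := a ⊗ₜ 1))
  rw [Submodule.mul_bot, tensorTop_bot, Submodule.mem_bot, colinearDefect, LinearMap.sub_apply,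
    sub_eq_zero] at h
  simpa [cofreeCoaction, Bialgebra.comul_one, Algebra.TensorProduct.one_def, average_apply,
    mem_coinvariants] using h.symm

end TotalIntegral

section Section

variable {π : A →ₐ[k] H} (hρ : IsComoduleAlgebra ρ) (hφ : IsTotalIntegral ρ φ)
  (hπφ : ∀ b, π (φ b) = b) (hcoact : ∀ a, π.toLinearMap.rTensor H (ρ a) = comul (π a))

include hπφ hcoact in
lemma apply_average (a : A) : π (average ρ φ a) = algebraMap k H (counit (π a)) :=
  map_average (τ := AlgHom.id k H) hπφ (by simpa using hcoact a)

include hρ hφ hπφ hcoact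

/-- With `ρ a = ∑ a₀ ⊗ a₁` one has `a = ∑ a₀ φ(S(a₁) a₂)`, which modulo `F 2` is the sum of the
products of the averages of the `a₀` with the `φ(a₁)`, since `φ` is multiplicative modulo `F 1`. -/
lemma adicFiltration_one_le_inf_coinvariants_mul_top_sup [Module.Flat k H] (hV : Commute V ⊤)
    (hker : LinearMap.ker π.toLinearMap = adicFiltration V 1) :
    adicFiltration V 1 ≤
      (adicFiltration V 1 ⊓ Subalgebra.toSubmodule (coinvariants ρ)) * ⊤ ⊔ adicFiltration V 2 := by
  have hsub : IsSubcomodule ρ (adicFiltration V 1) := hker ▸ isSubcomodule_ker hcoact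
  have hmul : adicFiltration V 1 * ⊤ ≤ adicFiltration V 1 := (adicFiltration_mul_top 1).le
  have hφmul (b c : H) : φ (b * c) - φ b * φ c ∈ adicFiltration V 1 :=
    hker ▸ by simp [LinearMap.mem_ker, hπφ]
  have hretract : tensorTop H (adicFiltration V 1) ≤
      ((adicFiltration V 1 ⊓ Subalgebra.toSubmodule (coinvariants ρ)) * ⊤ ⊔
        adicFiltration V 2).comap (retract ρ φ) := by
    refine tensorTop_le.2 fun a ha b => ?_
    have hmod := hsub.retract_tmul_sub_mem hφmul ha b
    rw [adicFiltration_mul hV] at hmod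
    rw [Submodule.mem_comap, ← sub_add_cancel (retract ρ φ (a ⊗ₜ b)) (average ρ φ a * φ b),
      add_comm]
    exact Submodule.add_mem_sup (Submodule.mul_mem_mul
      ⟨hsub.average_mem hmul ha, average_mem_coinvariants hρ hφ a⟩ Submodule.mem_top) hmod
  intro a ha
  rw [← hρ.retract_coaction hφ.map_one a]
  exact hretract (hsub a ha)

end Section

section Adjoin

lemma pow_le_toSubmodule {S : Subalgebra k A} (h : V ≤ Subalgebra.toSubmodule S) (n : ℕ) :
    V ^ n ≤ Subalgebra.toSubmodule S := by
  induction n with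
  | zero => exact pow_zero V ▸ Submodule.one_le.2 S.one_mem
  | succ n ih => exact pow_succ V n ▸ Submodule.mul_le.2 fun a ha b hb => S.mul_mem (ih ha) (h hb)

variable {π : A →ₐ[k] H} (hρ : IsComoduleAlgebra ρ) (hφ : IsTotalIntegral ρ φ)
  (hπφ : ∀ b, π (φ b) = b) (hcoact : ∀ a, π.toLinearMap.rTensor H (ρ a) = comul (π a))
  (hΘ : Θ ≤ Subalgebra.toSubmodule (coinvariants ρ))
  (hker : LinearMap.ker π.toLinearMap = adicFiltration Θ 1)

include hπφ hcoact hΘ hker in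
lemma average_mul_sub_smul_mem {a : A} (ha : a ∈ adicFiltration Θ 1) (b : A) :
    average ρ φ (a * b) - counit (R := k) (π b) • average ρ φ a ∈ adicFiltration Θ 2 := by
  rw [adicFiltration_one] at ha
  induction ha using Submodule.mul_induction_on' with
  | mem_mul_mem v hv c _ =>
    have hmem : average ρ φ (c * b) - counit (R := k) (π b) • average ρ φ c ∈
        adicFiltration Θ 1 := by
      rw [← hker]
      simp [LinearMap.mem_ker, apply_average hπφ hcoact, Algebra.smul_def, mul_comm]
    rw [mul_assoc, average_coinvariant_mul (hΘ hv), average_coinvariant_mul (hΘ hv),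
      ← mul_smul_comm, ← mul_sub, adicFiltration_succ]
    exact Submodule.mul_mem_mul hv hmem
  | add x _ y _ hx hy =>
    convert add_mem hx hy using 1
    simp only [add_mul, map_add, smul_add]
    abel

include hρ hφ hπφ hcoact hΘ hker

/-- For `v ∈ Θ ^ n` the average `v * average a` of `v * a` is a multiple of `v` modulo
`F (n + 1)`. -/
lemma average_mem_pow_sup {n : ℕ} {a : A} (ha : a ∈ adicFiltration Θ n) :
    average ρ φ a ∈
      Θ ^ n ⊔ adicFiltration Θ (n + 1) ⊓ Subalgebra.toSubmodule (coinvariants ρ) := by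
  rw [adicFiltration] at ha
  induction ha using Submodule.mul_induction_on' with
  | mem_mul_mem v hv a _ =>
    have hvρ : v ∈ coinvariants ρ := pow_le_toSubmodule hΘ n hv
    have haρ := average_mem_coinvariants hρ hφ a
    have hmem : average ρ φ a - algebraMap k A (counit (π a)) ∈ adicFiltration Θ 1 := by
      rw [← hker]
      simp [LinearMap.mem_ker, apply_average hπφ hcoact]
    rw [average_coinvariant_mul hvρ, ← add_sub_cancel (algebraMap k A (counit (π a)))
      (average ρ φ a), mul_add]
    refine Submodule.add_mem_sup ?_ ⟨?_, (coinvariants ρ).mul_mem hvρ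
      ((coinvariants ρ).sub_mem haρ ((coinvariants ρ).algebraMap_mem _))⟩
    · rw [← Algebra.commutes, ← Algebra.smul_def]
      exact Submodule.smul_mem _ _ hv
    · rw [adicFiltration, pow_succ, mul_assoc, ← adicFiltration_one]
      exact Submodule.mul_mem_mul hv hmem
  | add x _ y _ hx hy => rw [map_add]; exact add_mem hx hy

theorem coinvariants_le_adjoin {N : ℕ} (hN : adicFiltration Θ N = ⊥) :
    coinvariants ρ ≤ Algebra.adjoin k (Θ : Set A) := by
  have hΘn (n : ℕ) : Θ ^ n ≤ Subalgebra.toSubmodule (Algebra.adjoin k (Θ : Set A)) :=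
    pow_le_toSubmodule (fun _ hv => Algebra.subset_adjoin hv) n
  have happrox (n : ℕ) : Subalgebra.toSubmodule (coinvariants ρ) ≤
      Subalgebra.toSubmodule (Algebra.adjoin k (Θ : Set A)) ⊔
        adicFiltration Θ n ⊓ Subalgebra.toSubmodule (coinvariants ρ) := by
    induction n with
    | zero => rw [adicFiltration_zero, top_inf_eq]; exact le_sup_right
    | succ n ih =>
      refine ih.trans (sup_le le_sup_left fun a ha => ?_)
      rw [← average_of_mem_coinvariants hρ hφ ha.2]
      exact sup_le_sup_right (hΘn n) _ (average_mem_pow_sup hρ hφ hπφ hcoact hΘ hker ha.1)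
  simpa [hN] using happrox N

end Adjoin

section Splitting

variable {σ : H →ₐ[k] A} (hρ : IsComoduleAlgebra ρ) (hσ : IsTotalIntegral ρ σ.toLinearMap)

include hσ

lemma IsTotalIntegral.coaction_apply (b : H) :
    ρ (σ b) = σ.toLinearMap.rTensor H (comul b) :=
  (sub_eq_zero.1 (LinearMap.congr_fun hσ.colinearDefect_eq_zero b)).symm

lemma average_apply_algHom (b : H) :
    average ρ σ.toLinearMap (σ b) = algebraMap k A (counit b) :=
  map_average (g := AlgHom.id k A) (τ := σ) (fun _ => rfl) <| by simp [hσ.coaction_apply]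

include hρ

lemma surjective_coinvariants_mul : Function.Surjective
    (LinearMap.mul' k A ∘ₗ
      TensorProduct.map (coinvariants ρ).val.toLinearMap σ.toLinearMap) := by
  rw [← LinearMap.range_eq_top, ← top_le_iff]
  have hretract : tensorTop H ⊤ ≤ (LinearMap.range (LinearMap.mul' k A ∘ₗ
      TensorProduct.map (coinvariants ρ).val.toLinearMap σ.toLinearMap)).comap
        (retract ρ σ.toLinearMap) := by
    refine tensorTop_le.2 fun a _ b => ⟨⟨_, average_mem_coinvariants hρ hσ a⟩ ⊗ₜ b, ?_⟩
    have h := isSubcomodule_top.retract_tmul_sub_mem (I := ⊥) (ρ := ρ) (φ := σ.toLinearMap)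
      (by simp) (Submodule.mem_top (x := a)) b
    rw [Submodule.mul_bot, Submodule.mem_bot, sub_eq_zero] at h
    exact h.symm
  intro a _
  rw [← hρ.retract_coaction hσ.map_one a]
  exact hretract (isSubcomodule_top a Submodule.mem_top)

lemma injective_coinvariants_mul : Function.Injective
    (LinearMap.mul' k A ∘ₗ
      TensorProduct.map (coinvariants ρ).val.toLinearMap σ.toLinearMap) := by
  let p : A →ₗ[k] coinvariants ρ := (average ρ σ.toLinearMap).codRestrict
    (Subalgebra.toSubmodule (coinvariants ρ)) (average_mem_coinvariants hρ hσ)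
  have hp (v : coinvariants ρ) (b : H) : p (v * σ b) = counit (R := k) b • v :=
    Subtype.ext <| by
      rw [LinearMap.codRestrict_apply, average_coinvariant_mul v.2, average_apply_algHom hσ,
        ← Algebra.commutes, ← Algebra.smul_def]
      rfl
  have hpt (v : coinvariants ρ) (t : H ⊗[k] H) :
      p.rTensor H ((v : A) ⊗ₜ 1 * σ.toLinearMap.rTensor H t) =
        (LinearMap.toSpanSingleton k _ v).rTensor H (counit.rTensor H t) := by
    induction t with
    | zero => simp
    | add x y hx hy => simp only [map_add, mul_add, hx, hy]
    | tmul b c => simp [hp]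
  refine Function.LeftInverse.injective (g := p.rTensor H ∘ₗ ρ.toLinearMap) fun u => ?_
  induction u with
  | zero => simp
  | add x y hx hy => simp only [map_add, hx, hy]
  | tmul v b => simp [mem_coinvariants.1 v.2, hσ.coaction_apply, hpt]

theorem bijective_coinvariants_mul : Function.Bijective
    (LinearMap.mul' k A ∘ₗ
      TensorProduct.map (coinvariants ρ).val.toLinearMap σ.toLinearMap) :=
  ⟨injective_coinvariants_mul hρ hσ, surjective_coinvariants_mul hρ hσ⟩

end Splitting

end Average

section OddSquare

variable {k A V : Type*} [Field k] [Ring A] [Algebra k A] [AddCommGroup V] [Module k V]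
  {𝒜 : ZMod 2 → Submodule k A} [IsSuperCommutative 𝒜]

lemma odd_mul_self (hk : ringChar k ≠ 2) {a : A} (ha : a ∈ 𝒜 1) : a * a = 0 := by
  have h2 : (2 : k) • (a * a) = 0 := by
    rw [two_smul]
    nth_rw 1 [IsSuperCommutative.mul_comm_of_odd a ha a ha]
    exact neg_add_cancel _
  exact (smul_eq_zero.1 h2).resolve_left (Ring.two_ne_zero hk)

/-- The homomorphism from the exterior algebra that extends a linear map with odd values; squares
of odd elements vanish as `2` is invertible. -/
def exteriorLift (hk : ringChar k ≠ 2) (g : V →ₗ[k] A) (hg : ∀ v, g v ∈ 𝒜 1) :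
    ExteriorAlgebra k V →ₐ[k] A :=
  ExteriorAlgebra.lift k ⟨g, fun v => odd_mul_self hk (hg v)⟩

lemma exteriorLift_ι (hk : ringChar k ≠ 2) (g : V →ₗ[k] A) (hg : ∀ v, g v ∈ 𝒜 1) (v : V) :
    exteriorLift hk g hg (ExteriorAlgebra.ι k v) = g v :=
  ExteriorAlgebra.lift_ι_apply k _ _ v

lemma range_eq_map_exteriorLift (hk : ringChar k ≠ 2) (g : V →ₗ[k] A) (hg : ∀ v, g v ∈ 𝒜 1) :
    LinearMap.range g =
      (LinearMap.range (ExteriorAlgebra.ι k)).map (exteriorLift hk g hg).toLinearMap := by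
  rw [← LinearMap.range_comp]
  congr 1
  ext v
  exact (exteriorLift_ι hk g hg v).symm

variable (k V) in
lemma range_ι_pow_eq_bot [Module.Finite k V] {n : ℕ} (hn : Module.finrank k V < n) :
    LinearMap.range (ExteriorAlgebra.ι k : V →ₗ[k] ExteriorAlgebra k V) ^ n = ⊥ := by
  have h : Module.finrank k (⋀[k]^n V) = 0 := by
    rw [exteriorPower.finrank_eq, Nat.choose_eq_zero_of_lt hn]
  exact Submodule.finrank_eq_zero.1 h

lemma range_pow_eq_bot_of_odd [Module.Finite k V] (hk : ringChar k ≠ 2) (g : V →ₗ[k] A)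
    (hg : ∀ v, g v ∈ 𝒜 1) {n : ℕ} (hn : Module.finrank k V < n) : LinearMap.range g ^ n = ⊥ := by
  rw [range_eq_map_exteriorLift hk g hg, ← Submodule.map_pow, range_ι_pow_eq_bot k V hn,
    Submodule.map_bot]

end OddSquare

section Superalgebra

variable {k A : Type*} [Field k] [Ring A] [Algebra k A]
  (𝒜 : ZMod 2 → Submodule k A) [GradedAlgebra 𝒜]

lemma proj_mem (i : ZMod 2) (a : A) : GradedAlgebra.proj 𝒜 i a ∈ 𝒜 i := by
  rw [GradedAlgebra.proj_apply]
  exact SetLike.coe_mem _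

lemma proj_add_proj (a : A) : GradedAlgebra.proj 𝒜 0 a + GradedAlgebra.proj 𝒜 1 a = a := by
  classical
  have h := DirectSum.sum_support_decompose 𝒜 a
  rw [Finset.sum_subset (Finset.subset_univ _) (by simp)] at h
  exact (Fin.sum_univ_two fun i => (DirectSum.decompose 𝒜 a i : A)).symm.trans h

variable {𝒜} {i j : ZMod 2} {a b : A}

lemma proj_of_mem (ha : a ∈ 𝒜 i) : GradedAlgebra.proj 𝒜 i a = a := by
  rw [GradedAlgebra.proj_apply]
  exact DirectSum.decompose_of_mem_same 𝒜 ha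

lemma proj_of_mem_ne (ha : a ∈ 𝒜 i) (h : i ≠ j) : GradedAlgebra.proj 𝒜 j a = 0 := by
  rw [GradedAlgebra.proj_apply]
  exact DirectSum.decompose_of_mem_ne 𝒜 ha h

lemma homogeneous_induction {P : A → Prop} (a : A) (h : ∀ i, ∀ a ∈ 𝒜 i, P a)
    (hadd : ∀ a b, P a → P b → P (a + b)) : P a := by
  rw [← proj_add_proj 𝒜 a]
  exact hadd _ _ (h 0 _ (proj_mem 𝒜 0 a)) (h 1 _ (proj_mem 𝒜 1 a))

lemma parity_of_even (ha : a ∈ 𝒜 0) : parity 𝒜 a = a := by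
  simp [parity, proj_of_mem ha, proj_of_mem_ne ha zero_ne_one]

lemma parity_of_odd (ha : a ∈ 𝒜 1) : parity 𝒜 a = -a := by
  simp [parity, proj_of_mem ha, proj_of_mem_ne ha one_ne_zero]

lemma parity_mem (ha : a ∈ 𝒜 i) : parity 𝒜 a ∈ 𝒜 i := by
  fin_cases i
  · exact (parity_of_even ha).symm ▸ ha
  · exact (parity_of_odd ha).symm ▸ neg_mem ha

lemma parity_parity (a : A) : parity 𝒜 (parity 𝒜 a) = a := by
  induction a using homogeneous_induction (𝒜 := 𝒜) with
  | hadd x y hx hy => simp only [map_add, hx, hy]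
  | h i a ha =>
  fin_cases i
  · rw [parity_of_even ha, parity_of_even ha]
  · rw [parity_of_odd ha, map_neg, parity_of_odd ha, neg_neg]

lemma parity_mul (a b : A) : parity 𝒜 (a * b) = parity 𝒜 a * parity 𝒜 b := by
  induction a using homogeneous_induction (𝒜 := 𝒜) with
  | hadd x y hx hy => simp only [add_mul, map_add, hx, hy]
  | h i a ha =>
  induction b using homogeneous_induction (𝒜 := 𝒜) with
  | hadd x y hx hy => simp only [mul_add, map_add, hx, hy]
  | h j b hb =>
  have hab : a * b ∈ 𝒜 (i + j) := SetLike.mul_mem_graded ha hb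
  fin_cases i <;> fin_cases j
  · rw [parity_of_even ha, parity_of_even hb, parity_of_even hab]
  · rw [parity_of_even ha, parity_of_odd hb, parity_of_odd hab, mul_neg]
  · rw [parity_of_odd ha, parity_of_even hb, parity_of_odd hab, neg_mul]
  · rw [parity_of_odd ha, parity_of_odd hb, parity_of_even (show a * b ∈ 𝒜 0 from hab),
      neg_mul_neg]

lemma algebraMap_mem_even (r : k) : algebraMap k A r ∈ 𝒜 0 := by
  rw [Algebra.algebraMap_eq_smul_one]
  exact Submodule.smul_mem _ _ (SetLike.one_mem_graded 𝒜)

lemma proj_zero_mul_of_odd (ha : a ∈ 𝒜 1) (b : A) :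
    GradedAlgebra.proj 𝒜 0 (a * b) = a * GradedAlgebra.proj 𝒜 1 b := by
  have h0 : a * GradedAlgebra.proj 𝒜 0 b ∈ 𝒜 (1 + 0) :=
    SetLike.mul_mem_graded ha (proj_mem 𝒜 0 b)
  have h1 : a * GradedAlgebra.proj 𝒜 1 b ∈ 𝒜 (1 + 1) :=
    SetLike.mul_mem_graded ha (proj_mem 𝒜 1 b)
  nth_rw 1 [← proj_add_proj 𝒜 b, mul_add, map_add, proj_of_mem_ne h0 (by decide), zero_add]
  exact proj_of_mem h1

lemma proj_one_mul (a b : A) : GradedAlgebra.proj 𝒜 1 (a * b) =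
    GradedAlgebra.proj 𝒜 0 a * GradedAlgebra.proj 𝒜 1 b +
      GradedAlgebra.proj 𝒜 1 a * GradedAlgebra.proj 𝒜 0 b := by
  have hmem (i j : ZMod 2) :
      GradedAlgebra.proj 𝒜 i a * GradedAlgebra.proj 𝒜 j b ∈ 𝒜 (i + j) :=
    SetLike.mul_mem_graded (proj_mem 𝒜 i a) (proj_mem 𝒜 j b)
  nth_rw 1 [← proj_add_proj 𝒜 a, ← proj_add_proj 𝒜 b]
  simp only [add_mul, mul_add, map_add]
  rw [proj_of_mem_ne (hmem 0 0) (by decide), proj_of_mem_ne (hmem 1 1) (by decide),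
    proj_of_mem (i := 1) (hmem 0 1), proj_of_mem (i := 1) (hmem 1 0), zero_add, add_zero, add_comm]

lemma proj_zero_mem_adicFiltration_two (ha : a ∈ adicFiltration (𝒜 1) 1) :
    GradedAlgebra.proj 𝒜 0 a ∈ adicFiltration (𝒜 1) 2 := by
  rw [adicFiltration_one] at ha
  induction ha using Submodule.mul_induction_on' with
  | mem_mul_mem o ho c _ =>
    rw [proj_zero_mul_of_odd ho]
    exact pow_le_adicFiltration (pow_two (𝒜 1) ▸ Submodule.mul_mem_mul ho (proj_mem 𝒜 1 c))
  | add x _ y _ hx hy => rw [map_add]; exact add_mem hx hy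

variable [IsSuperCommutative 𝒜]

lemma odd_mul (ha : a ∈ 𝒜 1) (b : A) : a * b = parity 𝒜 b * a := by
  induction b using homogeneous_induction (𝒜 := 𝒜) with
  | hadd x y hx hy => simp only [mul_add, add_mul, map_add, hx, hy]
  | h i b hb =>
  fin_cases i
  · rw [parity_of_even hb]
    exact (IsSuperCommutative.mul_comm_of_even 1 b hb a ha).symm
  · rw [parity_of_odd hb, neg_mul]
    exact IsSuperCommutative.mul_comm_of_odd a ha b hb

lemma mul_odd (ha : a ∈ 𝒜 1) (b : A) : b * a = a * parity 𝒜 b := by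
  rw [odd_mul ha, parity_parity]

lemma even_mul_comm (ha : a ∈ 𝒜 0) (b : A) : a * b = b * a := by
  induction b using homogeneous_induction (𝒜 := 𝒜) with
  | hadd x y hx hy => simp only [mul_add, add_mul, hx, hy]
  | h i b hb => exact IsSuperCommutative.mul_comm_of_even i a ha b hb

lemma commute_top_of_le_odd {V : Submodule k A} (hV : V ≤ 𝒜 1) : Commute V ⊤ := by
  refine le_antisymm (Submodule.mul_le.2 fun v hv a _ => ?_)
    (Submodule.mul_le.2 fun a _ v hv => ?_)
  · rw [odd_mul (hV hv)]
    exact Submodule.mul_mem_mul Submodule.mem_top hv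
  · rw [mul_odd (hV hv)]
    exact Submodule.mul_mem_mul hv Submodule.mem_top

lemma mem_superRadical : a ∈ superRadical 𝒜 ↔ a ∈ adicFiltration (𝒜 1) 1 := by
  constructor
  · intro ha
    induction ha using Submodule.span_induction with
    | mem x hx => exact le_adicFiltration_one hx
    | zero => exact zero_mem _
    | add x y _ _ hx hy => exact add_mem hx hy
    | smul c x _ hx => exact mul_mem_adicFiltration_left (commute_top_of_le_odd le_rfl) c hx
  · intro ha
    rw [adicFiltration_one] at ha
    induction ha using Submodule.mul_induction_on' with
    | mem_mul_mem o ho c _ => exact Ideal.mul_mem_right _ _ (Ideal.subset_span ho)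
    | add x _ y _ hx hy => exact add_mem hx hy

lemma mem_superRadical_mul_superRadical :
    a ∈ superRadical 𝒜 * superRadical 𝒜 ↔ a ∈ adicFiltration (𝒜 1) 2 := by
  have hsq : adicFiltration (𝒜 1) 1 * adicFiltration (𝒜 1) 1 = adicFiltration (𝒜 1) 2 :=
    adicFiltration_mul (commute_top_of_le_odd le_rfl) 1 1
  rw [← hsq]
  constructor
  · intro ha
    induction ha using Submodule.smul_induction_on' with
    | smul x hx y hy =>
      exact Submodule.mul_mem_mul (mem_superRadical.1 hx) (mem_superRadical.1 hy)
    | add x _ y _ hx hy => exact add_mem hx hy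
  · intro ha
    induction ha using Submodule.mul_induction_on' with
    | mem_mul_mem x hx y hy =>
      exact Ideal.mul_mem_mul (mem_superRadical.2 hx) (mem_superRadical.2 hy)
    | add x _ y _ hx hy => exact add_mem hx hy

variable (𝒜) in
/-- The odd parts of finitely many algebra generators generate the super radical. -/
lemma exists_finite_odd_generators [Algebra.FiniteType k A] :
    ∃ U ≤ 𝒜 1, Module.Finite k U ∧ adicFiltration (𝒜 1) 1 = adicFiltration U 1 := by
  obtain ⟨S, hS⟩ := ‹Algebra.FiniteType k A›.out
  let U : Submodule k A := Submodule.span k (GradedAlgebra.proj 𝒜 1 '' S)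
  have hU : U ≤ 𝒜 1 := Submodule.span_le.2 <| by rintro _ ⟨x, -, rfl⟩; exact proj_mem 𝒜 1 x
  have hproj (a : A) : GradedAlgebra.proj 𝒜 1 a ∈ adicFiltration U 1 := by
    have ha : a ∈ Algebra.adjoin k (S : Set A) := hS ▸ Algebra.mem_top
    induction ha using Algebra.adjoin_induction with
    | mem x hx => exact le_adicFiltration_one (Submodule.subset_span ⟨x, hx, rfl⟩)
    | algebraMap r => rw [proj_of_mem_ne (algebraMap_mem_even r) zero_ne_one]; exact zero_mem _
    | add x y _ _ hx hy => rw [map_add]; exact add_mem hx hy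
    | mul x y _ _ hx hy =>
      rw [proj_one_mul]
      exact add_mem (mul_mem_adicFiltration_left (commute_top_of_le_odd hU) _ hy)
        (mul_mem_adicFiltration_right hx _)
  refine ⟨U, hU, Module.Finite.span_of_finite k (S.finite_toSet.image _), le_antisymm ?_ ?_⟩
  · rw [adicFiltration_one]
    exact Submodule.mul_le.2 fun o ho a _ =>
      mul_mem_adicFiltration_right (proj_of_mem ho ▸ hproj o) a
  · rw [adicFiltration_one, adicFiltration_one]
    gcongr

variable (𝒜) in
lemma exists_adicFiltration_odd_eq_bot [Algebra.FiniteType k A] (hk : ringChar k ≠ 2) :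
    ∃ N, adicFiltration (𝒜 1) N = ⊥ := by
  obtain ⟨U, hU, _, h⟩ := exists_finite_odd_generators 𝒜
  refine ⟨Module.finrank k U + 1, ?_⟩
  have hpow := range_pow_eq_bot_of_odd (n := Module.finrank k U + 1) hk U.subtype
    (fun u => hU u.2) (Nat.lt_succ_self _)
  rw [Submodule.range_subtype] at hpow
  rw [adicFiltration_eq_of_one_eq (commute_top_of_le_odd le_rfl) (commute_top_of_le_odd hU) h,
    adicFiltration, hpow, Submodule.bot_mul]

end Superalgebra

section Coassociativity

open Coalgebra

variable {k A C H : Type*} [CommRing k] [AddCommGroup A] [Module k A] [Coalgebra k A]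
  [AddCommGroup C] [Module k C] [AddCommGroup H] [Module k H]

lemma assoc_rTensor_map_comul {g : A →ₗ[k] C} {π : A →ₗ[k] H} {ρ : C →ₗ[k] C ⊗[k] H}
    {Δ : H →ₗ[k] H ⊗[k] H} (hρ : ρ ∘ₗ g = TensorProduct.map g π ∘ₗ comul)
    (hΔ : Δ ∘ₗ π = TensorProduct.map π π ∘ₗ comul) (a : A) :
    TensorProduct.assoc k C H H (ρ.rTensor H (TensorProduct.map g π (comul a))) =
      Δ.lTensor C (TensorProduct.map g π (comul a)) := by
  calc TensorProduct.assoc k C H H (ρ.rTensor H (TensorProduct.map g π (comul a)))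
    _ = TensorProduct.assoc k C H H
          (TensorProduct.map (TensorProduct.map g π) π (comul.rTensor A (comul a))) := by
      rw [← LinearMap.comp_apply (ρ.rTensor H), LinearMap.rTensor_comp_map, hρ,
        ← LinearMap.comp_apply (TensorProduct.map _ π) (comul.rTensor A),
        LinearMap.map_comp_rTensor]
    _ = TensorProduct.map g (TensorProduct.map π π)
          (TensorProduct.assoc k A A A (comul.rTensor A (comul a))) :=
      (LinearMap.congr_fun (TensorProduct.map_map_comp_assoc_eq g π π) _).symm
    _ = Δ.lTensor C (TensorProduct.map g π (comul a)) := by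
      rw [coassoc_apply, ← LinearMap.comp_apply (TensorProduct.map g _),
        LinearMap.map_comp_lTensor, ← LinearMap.comp_apply (Δ.lTensor C),
        LinearMap.lTensor_comp_map, hΔ]

end Coassociativity

section SignRule

variable {k A : Type*} [Field k] [Ring A] [Algebra k A]
  (𝒜 : ZMod 2 → Submodule k A) [GradedAlgebra 𝒜]

lemma of_tmul_mul_of_tmul (a b a' b' : A) :
    GradedTensorProduct.of k 𝒜 𝒜 (a ⊗ₜ b) * GradedTensorProduct.of k 𝒜 𝒜 (a' ⊗ₜ b') =
      GradedTensorProduct.of k 𝒜 𝒜 ((a * GradedAlgebra.proj 𝒜 0 a') ⊗ₜ (b * b') +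
        (a * GradedAlgebra.proj 𝒜 1 a') ⊗ₜ (parity 𝒜 b * b')) := by
  induction b using homogeneous_induction (𝒜 := 𝒜) with
  | hadd x y hx hy =>
    simp only [TensorProduct.tmul_add, map_add, add_mul] at hx hy ⊢
    rw [hx, hy, add_add_add_comm]
  | h i b hb =>
    have hmul (j : ZMod 2) := GradedTensorProduct.tmul_coe_mul_coe_tmul (R := k) 𝒜 𝒜 a
      ⟨b, hb⟩ ⟨_, proj_mem 𝒜 j a'⟩ b'
    nth_rw 1 [← proj_add_proj 𝒜 a']
    rw [TensorProduct.add_tmul, map_add, mul_add, map_add]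
    congr 1
    · exact (hmul 0).trans (by rw [mul_zero, uzpow_zero, one_smul])
    · refine (hmul 1).trans ?_
      fin_cases i
      · rw [parity_of_even hb]
        exact (congrArg (· • _) (uzpow_zero _)).trans (one_smul _ _)
      · rw [parity_of_odd hb, neg_mul, TensorProduct.tmul_neg, map_neg]
        exact (congrArg (· • _) (uzpow_one _)).trans (by rw [Units.neg_smul, one_smul])

variable [Coalgebra k A] [IsSuperAffineHopfAlgebra 𝒜]

/-- To compute `Φ (Δ (a b))` it is enough to expand `Φ ((a ⊗ b) (a' ⊗ b'))` by the sign rule. -/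
lemma apply_comul_mul {C : Type*} [AddCommGroup C] [Module k C] (Φ : A ⊗[k] A →ₗ[k] C)
    (Ψ : A ⊗[k] A →ₗ[k] A ⊗[k] A →ₗ[k] C)
    (h : ∀ a b a' b', Φ ((a * GradedAlgebra.proj 𝒜 0 a') ⊗ₜ (b * b')) +
      Φ ((a * GradedAlgebra.proj 𝒜 1 a') ⊗ₜ (parity 𝒜 b * b')) = Ψ (a ⊗ₜ b) (a' ⊗ₜ b'))
    (a b : A) : Φ (Coalgebra.comul (a * b)) = Ψ (Coalgebra.comul a) (Coalgebra.comul b) := by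
  let of := GradedTensorProduct.of k 𝒜 𝒜
  suffices hmul : ∀ x y, Φ (of.symm (of x * of y)) = Ψ x y by
    rw [← hmul, ← IsSuperAffineHopfAlgebra.comul_mul, LinearEquiv.symm_apply_apply]
  intro x y
  induction x with
  | zero => simp
  | add u v hu hv => simp only [map_add, add_mul, LinearMap.add_apply, hu, hv]
  | tmul a b =>
  induction y with
  | zero => simp
  | add u v hu hv => simp only [map_add, mul_add, hu, hv]
  | tmul a' b' =>
    rw [← h, of_tmul_mul_of_tmul, LinearEquiv.symm_apply_apply, map_add]

variable {𝒜} in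
lemma rTensor_proj_comul {i p : ZMod 2} {a : A} (ha : a ∈ 𝒜 i) :
    (GradedAlgebra.proj 𝒜 p).rTensor A (Coalgebra.comul a) =
      (GradedAlgebra.proj 𝒜 (i - p)).lTensor A (Coalgebra.comul a) := by
  suffices h : ∀ t ∈ tensorGrading 𝒜 𝒜 i, (GradedAlgebra.proj 𝒜 p).rTensor A
      ((GradedTensorProduct.of k 𝒜 𝒜).symm t) = (GradedAlgebra.proj 𝒜 (i - p)).lTensor A
      ((GradedTensorProduct.of k 𝒜 𝒜).symm t) from h _ (IsSuperAffineHopfAlgebra.comul_mem i a ha)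
  intro t ht
  refine LinearMap.eqOn_span (f := (GradedAlgebra.proj 𝒜 p).rTensor A ∘ₗ _)
    (g := (GradedAlgebra.proj 𝒜 (i - p)).lTensor A ∘ₗ _) ?_ ht
  rintro _ ⟨q, r, rfl, x, hx, y, hy, rfl⟩
  simp only [LinearMap.comp_apply, LinearEquiv.coe_coe, LinearEquiv.symm_apply_apply,
    LinearMap.rTensor_tmul, LinearMap.lTensor_tmul]
  by_cases hqp : q = p
  · rw [hqp, add_sub_cancel_left, proj_of_mem (hqp ▸ hx), proj_of_mem hy]
  · rw [proj_of_mem_ne hx hqp, proj_of_mem_ne hy (by grind), TensorProduct.zero_tmul,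
      TensorProduct.tmul_zero]

end SignRule

section EvenQuotient

open Coalgebra

variable {k A : Type*} [Field k] [Ring A] [Algebra k A]
  (𝒜 : ZMod 2 → Submodule k A)

lemma algHom_eq_zero_of_mem_superRadical {C : Type*} [Ring C] [Algebra k C] {g : A →ₐ[k] C}
    (hg : ∀ a ∈ 𝒜 1, g a = 0) (a : A) (ha : a ∈ superRadical 𝒜) : g a = 0 :=
  (Ideal.span_le.2 hg : superRadical 𝒜 ≤ RingHom.ker g) ha

variable [GradedAlgebra 𝒜]

section IsSuperCommutative

variable [IsSuperCommutative 𝒜]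

lemma piMap_surjective : Function.Surjective (piMap 𝒜) := Ideal.Quotient.mk_surjective

lemma ker_piMap : LinearMap.ker (piMap 𝒜).toLinearMap = adicFiltration (𝒜 1) 1 := by
  ext a
  exact Ideal.Quotient.eq_zero_iff_mem.trans mem_superRadical

lemma piMap_odd {a : A} (ha : a ∈ 𝒜 1) : piMap 𝒜 a = 0 :=
  Ideal.Quotient.eq_zero_iff_mem.2 (Ideal.subset_span ha)

lemma piMap_proj_zero (a : A) : piMap 𝒜 (GradedAlgebra.proj 𝒜 0 a) = piMap 𝒜 a := by
  nth_rw 2 [← proj_add_proj 𝒜 a]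
  rw [map_add, piMap_odd 𝒜 (proj_mem 𝒜 1 a), add_zero]

lemma piMap_comp_proj_zero :
    (piMap 𝒜).toLinearMap ∘ₗ GradedAlgebra.proj 𝒜 0 = (piMap 𝒜).toLinearMap :=
  LinearMap.ext (piMap_proj_zero 𝒜)

lemma piMap_comp_proj_one : (piMap 𝒜).toLinearMap ∘ₗ GradedAlgebra.proj 𝒜 1 = 0 :=
  LinearMap.ext fun a => piMap_odd 𝒜 (proj_mem 𝒜 1 a)

lemma piMap_parity (a : A) : piMap 𝒜 (parity 𝒜 a) = piMap 𝒜 a := by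
  rw [parity, LinearMap.sub_apply, map_sub, piMap_odd 𝒜 (proj_mem 𝒜 1 a), sub_zero,
    piMap_proj_zero]

end IsSuperCommutative

variable [Coalgebra k A] [IsSuperAffineHopfAlgebra 𝒜]

/-- The coaction of `B` on `A` as a homomorphism of algebras. -/
def coactionHom : A →ₐ[k] A ⊗[k] Bquot 𝒜 :=
  AlgHom.ofLinearMap (coaction 𝒜)
    (by
      have h : comul (R := k) (1 : A) = 1 ⊗ₜ 1 := IsSuperAffineHopfAlgebra.comul_one (𝒜 := 𝒜)
      simp [coaction, h, Algebra.TensorProduct.one_def])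
    (apply_comul_mul 𝒜 ((piMap 𝒜).toLinearMap.lTensor A)
      ((LinearMap.mul k (A ⊗[k] Bquot 𝒜)).compl₁₂ ((piMap 𝒜).toLinearMap.lTensor A)
        ((piMap 𝒜).toLinearMap.lTensor A)) fun a b a' b' => by
      simp only [LinearMap.lTensor_tmul, AlgHom.toLinearMap_apply, map_mul, piMap_parity,
        LinearMap.compl₁₂_apply, LinearMap.mul_apply', Algebra.TensorProduct.tmul_mul_tmul,
        ← TensorProduct.add_tmul, ← mul_add, proj_add_proj])

lemma coactionHom_apply (a : A) :
    coactionHom 𝒜 a = (piMap 𝒜).toLinearMap.lTensor A (comul a) := rfl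

lemma map_piMap_comul (a : A) :
    TensorProduct.map (piMap 𝒜).toLinearMap (piMap 𝒜).toLinearMap (comul a) =
      (piMap 𝒜).toLinearMap.rTensor (Bquot 𝒜) (coactionHom 𝒜 a) := by
  rw [coactionHom_apply, ← LinearMap.comp_apply (LinearMap.rTensor _ _),
    LinearMap.rTensor_comp_lTensor]

lemma coactionHom_proj (i : ZMod 2) (a : A) : coactionHom 𝒜 (GradedAlgebra.proj 𝒜 i a) =
    (GradedAlgebra.proj 𝒜 i).rTensor (Bquot 𝒜) (coactionHom 𝒜 a) := by
  induction a using homogeneous_induction (𝒜 := 𝒜) with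
  | hadd x y hx hy => simp only [map_add, hx, hy]
  | h j a ha =>
    have h : (GradedAlgebra.proj 𝒜 i).rTensor (Bquot 𝒜) (coactionHom 𝒜 a) =
        ((piMap 𝒜).toLinearMap ∘ₗ GradedAlgebra.proj 𝒜 (j - i)).lTensor A (comul a) := by
      rw [coactionHom_apply, ← LinearMap.comp_apply (LinearMap.rTensor _ _),
        LinearMap.rTensor_comp_lTensor, ← LinearMap.lTensor_comp_rTensor, LinearMap.comp_apply,
        rTensor_proj_comul ha, LinearMap.lTensor_comp, LinearMap.comp_apply]
    rw [h]
    rcases eq_or_ne j i with rfl | hij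
    · rw [proj_of_mem ha, sub_self, piMap_comp_proj_zero, coactionHom_apply]
    · have hji : j - i = 1 := by
        clear * - hij
        revert i j
        decide
      rw [proj_of_mem_ne ha hij, map_zero, hji, piMap_comp_proj_one, LinearMap.lTensor_zero,
        LinearMap.zero_apply]

lemma rTensor_piMap_coactionHom_odd {a : A} (ha : a ∈ 𝒜 1) :
    (piMap 𝒜).toLinearMap.rTensor (Bquot 𝒜) (coactionHom 𝒜 a) = 0 := by
  rw [← proj_of_mem ha, coactionHom_proj, ← LinearMap.comp_apply, ← LinearMap.rTensor_comp,
    piMap_comp_proj_one, LinearMap.rTensor_zero, LinearMap.zero_apply]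

/-- The counit of `B = A / J`. -/
def quotCounit : Bquot 𝒜 →ₐ[k] k :=
  Ideal.Quotient.liftₐ (superRadical 𝒜)
    (AlgHom.ofLinearMap counit (IsSuperAffineHopfAlgebra.counit_one 𝒜)
      (IsSuperAffineHopfAlgebra.counit_mul 𝒜))
    (algHom_eq_zero_of_mem_superRadical 𝒜 IsSuperAffineHopfAlgebra.counit_odd)

/-- The comultiplication of `B = A / J`. -/
def quotComul : Bquot 𝒜 →ₐ[k] Bquot 𝒜 ⊗[k] Bquot 𝒜 :=
  Ideal.Quotient.liftₐ (superRadical 𝒜)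
    ((Algebra.TensorProduct.map (piMap 𝒜) (AlgHom.id k (Bquot 𝒜))).comp (coactionHom 𝒜))
    (algHom_eq_zero_of_mem_superRadical 𝒜 fun _ => rTensor_piMap_coactionHom_odd 𝒜)

lemma quotComul_comp_piMap : (quotComul 𝒜).toLinearMap ∘ₗ (piMap 𝒜).toLinearMap =
    TensorProduct.map (piMap 𝒜).toLinearMap (piMap 𝒜).toLinearMap ∘ₗ comul :=
  LinearMap.ext fun a => (map_piMap_comul 𝒜 a).symm

lemma quotCounit_comp_piMap :
    (quotCounit 𝒜).toLinearMap ∘ₗ (piMap 𝒜).toLinearMap = counit := rfl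

lemma quotComul_piMap (a : A) : quotComul 𝒜 (piMap 𝒜 a) =
    TensorProduct.map (piMap 𝒜).toLinearMap (piMap 𝒜).toLinearMap (comul a) :=
  LinearMap.congr_fun (quotComul_comp_piMap 𝒜) a

instance : Bialgebra k (Bquot 𝒜) :=
  Bialgebra.ofAlgHom (quotComul 𝒜) (quotCounit 𝒜)
    (Ideal.Quotient.algHom_ext _ <| by
      ext a
      change TensorProduct.assoc k _ _ _ ((quotComul 𝒜).toLinearMap.rTensor _
        (quotComul 𝒜 (piMap 𝒜 a))) = (quotComul 𝒜).toLinearMap.lTensor _ (quotComul 𝒜 (piMap 𝒜 a))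
      rw [quotComul_piMap]
      exact assoc_rTensor_map_comul (quotComul_comp_piMap 𝒜) (quotComul_comp_piMap 𝒜) a)
    (Ideal.Quotient.algHom_ext _ <| by
      ext a
      change (quotCounit 𝒜).toLinearMap.rTensor _ (quotComul 𝒜 (piMap 𝒜 a)) = 1 ⊗ₜ piMap 𝒜 a
      rw [quotComul_piMap, ← LinearMap.comp_apply, LinearMap.rTensor_comp_map,
        quotCounit_comp_piMap, ← LinearMap.lTensor_comp_rTensor, LinearMap.comp_apply,
        rTensor_counit_comul, LinearMap.lTensor_tmul]
      rfl)
    (Ideal.Quotient.algHom_ext _ <| by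
      ext a
      change (quotCounit 𝒜).toLinearMap.lTensor _ (quotComul 𝒜 (piMap 𝒜 a)) = piMap 𝒜 a ⊗ₜ 1
      rw [quotComul_piMap, ← LinearMap.comp_apply, LinearMap.lTensor_comp_map,
        quotCounit_comp_piMap, ← LinearMap.rTensor_comp_lTensor, LinearMap.comp_apply,
        lTensor_counit_comul, LinearMap.rTensor_tmul]
      rfl)

lemma counit_piMap (a : A) : counit (R := k) (piMap 𝒜 a) = counit (R := k) a := rfl

lemma comul_comp_piMap : comul ∘ₗ (piMap 𝒜).toLinearMap =
    TensorProduct.map (piMap 𝒜).toLinearMap (piMap 𝒜).toLinearMap ∘ₗ comul :=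
  quotComul_comp_piMap 𝒜

lemma rTensor_piMap_coactionHom (a : A) :
    (piMap 𝒜).toLinearMap.rTensor (Bquot 𝒜) (coactionHom 𝒜 a) = comul (piMap 𝒜 a) := rfl

lemma isComoduleAlgebra_coactionHom : IsComoduleAlgebra (coactionHom 𝒜) where
  coassoc := assoc_rTensor_map_comul (g := LinearMap.id) rfl (comul_comp_piMap 𝒜)
  lTensor_counit a := by
    rw [coactionHom_apply, ← LinearMap.comp_apply, ← LinearMap.lTensor_comp]
    exact lTensor_counit_comul a

/-- An antipode of `A`, which is unique. -/
def superAntipode : A →ₐ[k] A := (IsSuperAffineHopfAlgebra.exists_antipode (𝒜 := 𝒜)).choose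

lemma superAntipode_mem (i : ZMod 2) (a : A) (ha : a ∈ 𝒜 i) : superAntipode 𝒜 a ∈ 𝒜 i :=
  (IsSuperAffineHopfAlgebra.exists_antipode (𝒜 := 𝒜)).choose_spec.1 i a ha

lemma mul'_rTensor_superAntipode_comul (a : A) :
    LinearMap.mul' k A ((superAntipode 𝒜).toLinearMap.rTensor A (comul a)) =
      algebraMap k A (counit a) :=
  (IsSuperAffineHopfAlgebra.exists_antipode (𝒜 := 𝒜)).choose_spec.2.1 a

lemma mul'_lTensor_superAntipode_comul (a : A) :
    LinearMap.mul' k A ((superAntipode 𝒜).toLinearMap.lTensor A (comul a)) =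
      algebraMap k A (counit a) :=
  (IsSuperAffineHopfAlgebra.exists_antipode (𝒜 := 𝒜)).choose_spec.2.2 a

/-- The antipode of `B = A / J`. -/
def quotAntipode : Bquot 𝒜 →ₐ[k] Bquot 𝒜 :=
  Ideal.Quotient.liftₐ (superRadical 𝒜) ((piMap 𝒜).comp (superAntipode 𝒜))
    (algHom_eq_zero_of_mem_superRadical 𝒜 fun a ha => piMap_odd 𝒜 (superAntipode_mem 𝒜 1 a ha))

lemma quotAntipode_comp_piMap : (quotAntipode 𝒜).toLinearMap ∘ₗ (piMap 𝒜).toLinearMap =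
    (piMap 𝒜).toLinearMap ∘ₗ (superAntipode 𝒜).toLinearMap := rfl

lemma mul'_map_piMap (t : A ⊗[k] A) : LinearMap.mul' k (Bquot 𝒜)
    (TensorProduct.map (piMap 𝒜).toLinearMap (piMap 𝒜).toLinearMap t) =
      piMap 𝒜 (LinearMap.mul' k A t) :=
  (LinearMap.congr_fun (AlgHom.comp_mul' (piMap 𝒜)) t).symm

instance : HopfAlgebra k (Bquot 𝒜) where
  antipode := (quotAntipode 𝒜).toLinearMap
  mul_antipode_rTensor_comul := by
    refine LinearMap.ext fun b => ?_
    obtain ⟨a, rfl⟩ := piMap_surjective 𝒜 b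
    change LinearMap.mul' k (Bquot 𝒜) ((quotAntipode 𝒜).toLinearMap.rTensor (Bquot 𝒜)
      (quotComul 𝒜 (piMap 𝒜 a))) = algebraMap k (Bquot 𝒜) (counit a)
    rw [quotComul_piMap, ← LinearMap.comp_apply (LinearMap.rTensor _ _),
      LinearMap.rTensor_comp_map, quotAntipode_comp_piMap, ← LinearMap.map_comp_rTensor,
      LinearMap.comp_apply, mul'_map_piMap, mul'_rTensor_superAntipode_comul, AlgHom.commutes]
  mul_antipode_lTensor_comul := by
    refine LinearMap.ext fun b => ?_
    obtain ⟨a, rfl⟩ := piMap_surjective 𝒜 b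
    change LinearMap.mul' k (Bquot 𝒜) ((quotAntipode 𝒜).toLinearMap.lTensor (Bquot 𝒜)
      (quotComul 𝒜 (piMap 𝒜 a))) = algebraMap k (Bquot 𝒜) (counit a)
    rw [quotComul_piMap, ← LinearMap.comp_apply (LinearMap.lTensor _ _),
      LinearMap.lTensor_comp_map, quotAntipode_comp_piMap, ← LinearMap.map_comp_lTensor,
      LinearMap.comp_apply, mul'_map_piMap, mul'_lTensor_superAntipode_comul, AlgHom.commutes]

end EvenQuotient

section InvariantOperators

open Coalgebra

variable {k A : Type*} [CommRing k] [AddCommGroup A] [Module k A]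

section

variable {M N : Type*} [AddCommGroup M] [Module k M] [AddCommGroup N] [Module k N]
  {W : Submodule k A} {f : M →ₗ[k] A}

lemma lid_map_mem (hf : ∀ x, f x ∈ W) (δ : N →ₗ[k] k) (t : N ⊗[k] M) :
    TensorProduct.lid k A (TensorProduct.map δ f t) ∈ W := by
  induction t with
  | zero => simp
  | add x y hx hy => rw [map_add, map_add]; exact add_mem hx hy
  | tmul x y => exact W.smul_mem _ (hf y)

lemma rid_map_mem (hf : ∀ x, f x ∈ W) (δ : N →ₗ[k] k) (t : M ⊗[k] N) :
    TensorProduct.rid k A (TensorProduct.map f δ t) ∈ W := by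
  induction t with
  | zero => simp
  | add x y hx hy => rw [map_add, map_add]; exact add_mem hx hy
  | tmul x y => exact W.smul_mem _ (hf x)

end

variable [Coalgebra k A]

/-- The right-invariant operator `(δ ⊗ id) ∘ Δ` of a functional `δ`. -/
def rightInvOp (δ : A →ₗ[k] k) : A →ₗ[k] A :=
  (TensorProduct.lid k A).toLinearMap ∘ₗ δ.rTensor A ∘ₗ comul

/-- The operator `(τ ⊗ δ) ∘ Δ` of a functional `δ`. If `δ` is odd and `τ` is the parity
involution, it is left-invariant in the sense of the sign rule. -/
def twistedLeftInvOp (τ : A →ₗ[k] A) (δ : A →ₗ[k] k) : A →ₗ[k] A :=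
  (TensorProduct.rid k A).toLinearMap ∘ₗ TensorProduct.map τ δ ∘ₗ comul

lemma lid_rTensor_counit_comul (a : A) :
    TensorProduct.lid k A ((counit (R := k)).rTensor A (comul a)) = a := by
  rw [rTensor_counit_comul, TensorProduct.lid_tmul, one_smul]

lemma rid_lTensor_counit_comul (a : A) :
    TensorProduct.rid k A ((counit (R := k)).lTensor A (comul a)) = a := by
  rw [lTensor_counit_comul, TensorProduct.rid_tmul, one_smul]

lemma counit_rightInvOp (δ : A →ₗ[k] k) (a : A) : counit (R := k) (rightInvOp δ a) = δ a := by
  have h : counit ∘ₗ (TensorProduct.lid k A).toLinearMap ∘ₗ δ.rTensor A =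
      δ ∘ₗ (TensorProduct.rid k A).toLinearMap ∘ₗ (counit (R := k)).lTensor A :=
    TensorProduct.ext' fun x y => by simp [mul_comm]
  exact (LinearMap.congr_fun h (comul a)).trans (congrArg δ (rid_lTensor_counit_comul a))

lemma counit_twistedLeftInvOp {τ : A →ₗ[k] A} (hτ : ∀ a, counit (R := k) (τ a) = counit (R := k) a)
    (δ : A →ₗ[k] k) (a : A) : counit (R := k) (twistedLeftInvOp τ δ a) = δ a := by
  have h : counit ∘ₗ (TensorProduct.rid k A).toLinearMap ∘ₗ TensorProduct.map τ δ =
      δ ∘ₗ (TensorProduct.lid k A).toLinearMap ∘ₗ (counit (R := k)).rTensor A :=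
    TensorProduct.ext' fun x y => by simp [hτ, mul_comm]
  exact (LinearMap.congr_fun h (comul a)).trans (congrArg δ (lid_rTensor_counit_comul a))

lemma comul_comp_rightInvOp (δ : A →ₗ[k] k) :
    comul ∘ₗ rightInvOp δ = (rightInvOp δ).rTensor A ∘ₗ comul := by
  let E : A ⊗[k] (A ⊗[k] A) →ₗ[k] A ⊗[k] A :=
    (TensorProduct.lid k (A ⊗[k] A)).toLinearMap ∘ₗ δ.rTensor (A ⊗[k] A)
  have hleft : comul ∘ₗ (TensorProduct.lid k A).toLinearMap ∘ₗ δ.rTensor A =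
      E ∘ₗ comul.lTensor A :=
    TensorProduct.ext' fun x y => by simp [E]
  have hright : ((TensorProduct.lid k A).toLinearMap ∘ₗ δ.rTensor A).rTensor A =
      E ∘ₗ (TensorProduct.assoc k A A A).toLinearMap :=
    TensorProduct.ext_threefold fun x y z => by simp [E, TensorProduct.smul_tmul']
  ext a
  calc comul (rightInvOp δ a)
    _ = E (comul.lTensor A (comul a)) := LinearMap.congr_fun hleft (comul a)
    _ = E (TensorProduct.assoc k A A A (comul.rTensor A (comul a))) := by rw [coassoc_apply]
    _ = ((TensorProduct.lid k A).toLinearMap ∘ₗ δ.rTensor A).rTensor A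
          (comul.rTensor A (comul a)) := (LinearMap.congr_fun hright _).symm
    _ = (rightInvOp δ).rTensor A (comul a) := by
      rw [← LinearMap.comp_apply, ← LinearMap.rTensor_comp]
      rfl

lemma comul_comp_twistedLeftInvOp {τ : A →ₗ[k] A} (hτ : comul ∘ₗ τ = TensorProduct.map τ τ ∘ₗ comul)
    (δ : A →ₗ[k] k) : comul ∘ₗ twistedLeftInvOp τ δ =
      TensorProduct.map τ (twistedLeftInvOp τ δ) ∘ₗ comul := by
  let E : A ⊗[k] (A ⊗[k] A) →ₗ[k] A ⊗[k] A :=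
    TensorProduct.map τ ((TensorProduct.rid k A).toLinearMap ∘ₗ TensorProduct.map τ δ)
  have hleft : comul ∘ₗ (TensorProduct.rid k A).toLinearMap ∘ₗ TensorProduct.map τ δ =
      E ∘ₗ (TensorProduct.assoc k A A A).toLinearMap ∘ₗ comul.rTensor A := by
    have h : (TensorProduct.rid k (A ⊗[k] A)).toLinearMap ∘ₗ
        TensorProduct.map (TensorProduct.map τ τ) δ =
          E ∘ₗ (TensorProduct.assoc k A A A).toLinearMap :=
      TensorProduct.ext_threefold fun x y z => by simp [E]
    rw [← LinearMap.comp_assoc _ _ E, ← h, LinearMap.comp_assoc, LinearMap.map_comp_rTensor, ← hτ]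
    exact TensorProduct.ext' fun x y => by simp
  ext a
  calc comul (twistedLeftInvOp τ δ a)
    _ = E (TensorProduct.assoc k A A A (comul.rTensor A (comul a))) :=
      LinearMap.congr_fun hleft (comul a)
    _ = E (comul.lTensor A (comul a)) := by rw [coassoc_apply]
    _ = TensorProduct.map τ (twistedLeftInvOp τ δ) (comul a) :=
      LinearMap.congr_fun (LinearMap.map_comp_lTensor _ _ _ _) (comul a)

lemma twistedLeftInvOp_counit_comp {τ D : A →ₗ[k] A}
    (hD : comul ∘ₗ D = TensorProduct.map τ D ∘ₗ comul) :
    twistedLeftInvOp τ (counit ∘ₗ D) = D := by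
  have h : TensorProduct.map τ (counit (R := k) ∘ₗ D) ∘ₗ comul =
      (counit (R := k)).lTensor A ∘ₗ comul ∘ₗ D := by
    rw [hD, ← LinearMap.comp_assoc, LinearMap.lTensor_comp_map]
  ext a
  rw [twistedLeftInvOp, h]
  exact rid_lTensor_counit_comul (D a)

end InvariantOperators

section OddPointDerivations

open Coalgebra

variable {k A : Type*} [Field k] [Ring A] [Algebra k A] (𝒜 : ZMod 2 → Submodule k A)
  [Coalgebra k A]

/-- The odd derivations `A → k` at the counit: the odd tangent space at the unit. -/
def oddPointDer : Submodule k (A →ₗ[k] k) where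
  carrier := {δ | (∀ a ∈ 𝒜 0, δ a = 0) ∧
    ∀ a b, δ (a * b) = δ a * counit (R := k) b + counit (R := k) a * δ b}
  add_mem' := by
    rintro δ η ⟨hδ, hδ'⟩ ⟨hη, hη'⟩
    refine ⟨fun a ha => by simp [hδ a ha, hη a ha], fun a b => ?_⟩
    simp only [LinearMap.add_apply, hδ', hη']
    ring
  zero_mem' := ⟨fun a _ => rfl, fun a b => by simp⟩
  smul_mem' := by
    rintro c δ ⟨hδ, hδ'⟩
    refine ⟨fun a ha => by simp [hδ a ha], fun a b => ?_⟩
    simp only [LinearMap.smul_apply, hδ', smul_eq_mul]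
    ring

variable {𝒜} [GradedAlgebra 𝒜] {δ : A →ₗ[k] k}

lemma oddPointDer_comp_proj_one (hδ : δ ∈ oddPointDer 𝒜) : δ ∘ₗ GradedAlgebra.proj 𝒜 1 = δ := by
  ext a
  nth_rw 2 [← proj_add_proj 𝒜 a]
  rw [map_add, hδ.1 _ (proj_mem 𝒜 0 a), zero_add, LinearMap.comp_apply]

lemma oddPointDer_proj_one (hδ : δ ∈ oddPointDer 𝒜) (a : A) :
    δ (GradedAlgebra.proj 𝒜 1 a) = δ a :=
  LinearMap.congr_fun (oddPointDer_comp_proj_one hδ) a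

lemma oddPointDer_parity (hδ : δ ∈ oddPointDer 𝒜) (a : A) : δ (parity 𝒜 a) = -δ a := by
  rw [parity, LinearMap.sub_apply, map_sub, hδ.1 _ (proj_mem 𝒜 0 a), zero_sub,
    oddPointDer_proj_one hδ]

variable [IsSuperAffineHopfAlgebra 𝒜]

variable (𝒜) in
lemma counit_proj_one (a : A) : counit (R := k) (GradedAlgebra.proj 𝒜 1 a) = 0 :=
  IsSuperAffineHopfAlgebra.counit_odd _ (proj_mem 𝒜 1 a)

variable (𝒜) in
lemma counit_proj_zero (a : A) :
    counit (R := k) (GradedAlgebra.proj 𝒜 0 a) = counit (R := k) a := by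
  nth_rw 2 [← proj_add_proj 𝒜 a]
  rw [map_add, counit_proj_one, add_zero]

variable (𝒜) in
lemma counit_parity (a : A) : counit (R := k) (parity 𝒜 a) = counit (R := k) a := by
  rw [parity, LinearMap.sub_apply, map_sub, counit_proj_one, sub_zero, counit_proj_zero]

lemma counit_eq_zero_of_mem_adicFiltration_one {a : A} (ha : a ∈ adicFiltration (𝒜 1) 1) :
    counit (R := k) a = 0 := by
  rw [← ker_piMap] at ha
  rw [← counit_piMap 𝒜, show piMap 𝒜 a = 0 from ha, map_zero]

lemma oddPointDer_eq_zero_of_mem_adicFiltration_two (hδ : δ ∈ oddPointDer 𝒜) {a : A}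
    (ha : a ∈ adicFiltration (𝒜 1) 2) : δ a = 0 := by
  have hsq : adicFiltration (𝒜 1) 1 * adicFiltration (𝒜 1) 1 = adicFiltration (𝒜 1) 2 :=
    adicFiltration_mul (commute_top_of_le_odd le_rfl) 1 1
  rw [← hsq] at ha
  induction ha using Submodule.mul_induction_on' with
  | mem_mul_mem x hx y hy =>
    rw [hδ.2, counit_eq_zero_of_mem_adicFiltration_one hx,
      counit_eq_zero_of_mem_adicFiltration_one hy, mul_zero, zero_mul, add_zero]
  | add x _ y _ hx hy => rw [map_add, hx, hy, add_zero]

lemma oddPointDer_eq_zero_of_forall_mem (hδ : δ ∈ oddPointDer 𝒜) {W : Submodule k A}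
    (hW : W ≤ 𝒜 1) (hgen : adicFiltration (𝒜 1) 1 ≤ W * ⊤ ⊔ adicFiltration (𝒜 1) 2)
    (h : ∀ w ∈ W, δ w = 0) : δ = 0 := by
  have hker : adicFiltration (𝒜 1) 1 ≤ LinearMap.ker δ := by
    refine hgen.trans (sup_le (Submodule.mul_le.2 fun w hw a _ => ?_)
      fun a => oddPointDer_eq_zero_of_mem_adicFiltration_two hδ)
    rw [LinearMap.mem_ker, hδ.2, h w hw, IsSuperAffineHopfAlgebra.counit_odd w (hW hw), zero_mul,
      zero_mul, add_zero]
  ext a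
  rw [← oddPointDer_proj_one hδ]
  exact hker (le_adicFiltration_one (proj_mem 𝒜 1 a))

variable (𝒜) in
lemma finite_oddPointDer : Module.Finite k (oddPointDer 𝒜) := by
  have := IsSuperAffineHopfAlgebra.finiteType (𝒜 := 𝒜)
  obtain ⟨U, hU, _, h⟩ := exists_finite_odd_generators 𝒜
  let restrict : oddPointDer 𝒜 →ₗ[k] Module.Dual k U :=
    LinearMap.lcomp k k U.subtype ∘ₗ (oddPointDer 𝒜).subtype
  refine Module.Finite.of_injective restrict ((injective_iff_map_eq_zero _).2 fun δ hδ => ?_)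
  exact Subtype.ext <| oddPointDer_eq_zero_of_forall_mem δ.2 hU
    (h.trans_le (adicFiltration_one.le.trans le_sup_left))
    fun w hw => LinearMap.congr_fun hδ (⟨w, hw⟩ : U)

lemma comul_comp_parity : comul ∘ₗ parity 𝒜 =
    TensorProduct.map (parity 𝒜) (parity 𝒜) ∘ₗ comul := by
  have hswap {i : ZMod 2} {a : A} (ha : a ∈ 𝒜 i) : (parity 𝒜).rTensor A (comul a) =
      (parity 𝒜).lTensor A (comul (parity 𝒜 a)) := by
    rw [parity, LinearMap.rTensor_sub, LinearMap.sub_apply, rTensor_proj_comul ha,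
      rTensor_proj_comul ha, ← parity]
    fin_cases i
    · rw [parity_of_even ha, parity, LinearMap.lTensor_sub, LinearMap.sub_apply]
      rfl
    · rw [parity_of_odd ha, parity, LinearMap.lTensor_sub, LinearMap.sub_apply, map_neg, map_neg,
        map_neg, sub_neg_eq_add, neg_add_eq_sub]
      rfl
  ext a
  rw [LinearMap.comp_apply, LinearMap.comp_apply]
  induction a using homogeneous_induction (𝒜 := 𝒜) with
  | hadd x y hx hy => simp only [map_add, hx, hy]
  | h i a ha =>
    have hinv : parity 𝒜 ∘ₗ parity 𝒜 = LinearMap.id := LinearMap.ext parity_parity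
    rw [← LinearMap.lTensor_comp_rTensor, LinearMap.comp_apply, hswap ha,
      ← LinearMap.comp_apply (LinearMap.lTensor _ _) (LinearMap.lTensor _ _),
      ← LinearMap.lTensor_comp, hinv, LinearMap.lTensor_id, LinearMap.id_apply]

lemma rightInvOp_mem (hδ : δ ∈ oddPointDer 𝒜) {i : ZMod 2} {a : A} (ha : a ∈ 𝒜 i) :
    rightInvOp δ a ∈ 𝒜 (i + 1) := by
  have h : δ.rTensor A (comul a) =
      TensorProduct.map δ (GradedAlgebra.proj 𝒜 (i - 1)) (comul a) := by
    nth_rw 1 [← oddPointDer_comp_proj_one hδ]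
    rw [LinearMap.rTensor_comp, LinearMap.comp_apply, rTensor_proj_comul ha,
      ← LinearMap.comp_apply, LinearMap.rTensor_comp_lTensor]
  rw [← ZMod.neg_eq_self_mod_two 1, ← sub_eq_add_neg, rightInvOp, LinearMap.comp_apply,
    LinearMap.comp_apply, h]
  exact lid_map_mem (proj_mem 𝒜 (i - 1)) δ _

lemma twistedLeftInvOp_parity_mem (hδ : δ ∈ oddPointDer 𝒜) {i : ZMod 2} {a : A} (ha : a ∈ 𝒜 i) :
    twistedLeftInvOp (parity 𝒜) δ a ∈ 𝒜 (i + 1) := by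
  have h : TensorProduct.map (parity 𝒜) δ (comul a) =
      TensorProduct.map (parity 𝒜 ∘ₗ GradedAlgebra.proj 𝒜 (i - 1)) δ (comul a) := by
    have hproj := rTensor_proj_comul (p := i - 1) ha
    rw [sub_sub_cancel] at hproj
    rw [← LinearMap.map_comp_rTensor, LinearMap.comp_apply, hproj,
      ← LinearMap.comp_apply (TensorProduct.map _ _) (LinearMap.lTensor _ _),
      LinearMap.map_comp_lTensor, oddPointDer_comp_proj_one hδ]
  rw [← ZMod.neg_eq_self_mod_two 1, ← sub_eq_add_neg, twistedLeftInvOp, LinearMap.comp_apply,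
    LinearMap.comp_apply, h]
  exact rid_map_mem (fun a => parity_mem (proj_mem 𝒜 (i - 1) a)) δ _

lemma rightInvOp_mul (hδ : δ ∈ oddPointDer 𝒜) (a b : A) :
    rightInvOp δ (a * b) = rightInvOp δ a * b + parity 𝒜 a * rightInvOp δ b := by
  let Φ : A ⊗[k] A →ₗ[k] A := (TensorProduct.lid k A).toLinearMap ∘ₗ δ.rTensor A
  let E : A ⊗[k] A →ₗ[k] A := (TensorProduct.lid k A).toLinearMap ∘ₗ (counit (R := k)).rTensor A
  have hE (a : A) : E (comul a) = a := lid_rTensor_counit_comul a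
  have h := apply_comul_mul 𝒜 Φ ((LinearMap.mul k A).compl₁₂ Φ E +
    (LinearMap.mul k A).compl₁₂ (parity 𝒜 ∘ₗ E) Φ) (fun a b a' b' => ?_) a b
  · simp only [LinearMap.add_apply, LinearMap.compl₁₂_apply, LinearMap.mul_apply',
      LinearMap.comp_apply (parity 𝒜), hE] at h
    exact h
  · change δ (a * GradedAlgebra.proj 𝒜 0 a') • (b * b') +
        δ (a * GradedAlgebra.proj 𝒜 1 a') • (parity 𝒜 b * b') =
      (δ a • b) * (counit (R := k) a' • b') + parity 𝒜 (counit (R := k) a • b) * (δ a' • b')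
    rw [hδ.2, hδ.2, hδ.1 _ (proj_mem 𝒜 0 a'), counit_proj_one, counit_proj_zero,
      oddPointDer_proj_one hδ, mul_zero, mul_zero, add_zero, zero_add, map_smul,
      smul_mul_smul_comm, smul_mul_smul_comm]

lemma twistedLeftInvOp_parity_mul (hδ : δ ∈ oddPointDer 𝒜) (a b : A) :
    twistedLeftInvOp (parity 𝒜) δ (a * b) =
      twistedLeftInvOp (parity 𝒜) δ a * b + parity 𝒜 a * twistedLeftInvOp (parity 𝒜) δ b := by
  let Φ : A ⊗[k] A →ₗ[k] A := (TensorProduct.rid k A).toLinearMap ∘ₗ TensorProduct.map (parity 𝒜) δ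
  let E : A ⊗[k] A →ₗ[k] A := (TensorProduct.rid k A).toLinearMap ∘ₗ (counit (R := k)).lTensor A
  have hE (a : A) : E (comul a) = a := rid_lTensor_counit_comul a
  have h := apply_comul_mul 𝒜 Φ ((LinearMap.mul k A).compl₁₂ Φ E +
    (LinearMap.mul k A).compl₁₂ (parity 𝒜 ∘ₗ E) Φ) (fun a b a' b' => ?_) a b
  · simp only [LinearMap.add_apply, LinearMap.compl₁₂_apply, LinearMap.mul_apply',
      LinearMap.comp_apply (parity 𝒜), hE] at h
    exact h
  · change δ (b * b') • parity 𝒜 (a * GradedAlgebra.proj 𝒜 0 a') +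
        δ (parity 𝒜 b * b') • parity 𝒜 (a * GradedAlgebra.proj 𝒜 1 a') =
      (δ b • parity 𝒜 a) * (counit (R := k) b' • a') +
        parity 𝒜 (counit (R := k) b • a) * (δ b' • parity 𝒜 a')
    have hparity : parity 𝒜 a' = GradedAlgebra.proj 𝒜 0 a' - GradedAlgebra.proj 𝒜 1 a' := rfl
    rw [hparity]
    nth_rw 3 [← proj_add_proj 𝒜 a']
    rw [hδ.2, hδ.2, counit_parity, oddPointDer_parity hδ, parity_mul, parity_mul,
      parity_of_even (proj_mem 𝒜 0 a'), parity_of_odd (proj_mem 𝒜 1 a'), map_smul,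
      smul_mul_smul_comm, smul_mul_smul_comm, mul_add, mul_neg, mul_sub]
    module

lemma isOddRightInvariant_rightInvOp (hδ : δ ∈ oddPointDer 𝒜) :
    IsOddRightInvariant 𝒜 (rightInvOp δ) :=
  ⟨⟨fun _ _ => rightInvOp_mem hδ, rightInvOp_mul hδ⟩, comul_comp_rightInvOp δ⟩

lemma twistedLeftInvOp_parity_mem_gMinus (hδ : δ ∈ oddPointDer 𝒜) :
    twistedLeftInvOp (parity 𝒜) δ ∈ gMinus 𝒜 :=
  ⟨⟨fun _ _ => twistedLeftInvOp_parity_mem hδ, twistedLeftInvOp_parity_mul hδ⟩,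
    comul_comp_twistedLeftInvOp comul_comp_parity δ⟩

lemma counit_comp_mem_oddPointDer {D : A →ₗ[k] A} (hD : D ∈ oddSuperDer 𝒜) :
    counit ∘ₗ D ∈ oddPointDer 𝒜 := by
  refine ⟨fun a ha => IsSuperAffineHopfAlgebra.counit_odd _ (by simpa using hD.1 0 a ha),
    fun a b => ?_⟩
  simp only [LinearMap.comp_apply, hD.2, map_add,
    IsSuperAffineHopfAlgebra.counit_mul (𝒜 := 𝒜), counit_parity 𝒜]

variable (𝒜) in
/-- A left-invariant odd superderivation is determined by its composite with the counit, which can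
be any odd derivation at the counit. -/
def gMinusEquiv : gMinus 𝒜 ≃ₗ[k] oddPointDer 𝒜 where
  toFun D := ⟨counit ∘ₗ (D : A →ₗ[k] A), counit_comp_mem_oddPointDer D.2.1⟩
  map_add' D E := by ext a; simp
  map_smul' c D := by ext a; simp
  invFun δ := ⟨twistedLeftInvOp (parity 𝒜) δ, twistedLeftInvOp_parity_mem_gMinus δ.2⟩
  left_inv D := Subtype.ext (twistedLeftInvOp_counit_comp D.2.2)
  right_inv δ := by
    ext a
    exact counit_twistedLeftInvOp (counit_parity 𝒜) _ a

variable (𝒜) in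
lemma finite_gMinus : Module.Finite k (gMinus 𝒜) :=
  have := finite_oddPointDer 𝒜
  Module.Finite.equiv (gMinusEquiv 𝒜).symm

end OddPointDerivations

section Existence

open Coalgebra

variable {k A : Type*} [Field k] [Ring A] [Algebra k A]
  (𝒜 : ZMod 2 → Submodule k A) [GradedAlgebra 𝒜] [Coalgebra k A] [IsSuperAffineHopfAlgebra 𝒜]

lemma exists_adicFiltration_eq_bot (hk : ringChar k ≠ 2) :
    ∃ N, adicFiltration (𝒜 1) N = ⊥ :=
  have := IsSuperAffineHopfAlgebra.finiteType 𝒜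
  exists_adicFiltration_odd_eq_bot 𝒜 hk

lemma exists_totalIntegral_piMap (hk : ringChar k ≠ 2) :
    ∃ φ : Bquot 𝒜 →ₗ[k] A, IsTotalIntegral (coactionHom 𝒜) φ ∧ ∀ b, piMap 𝒜 (φ b) = b := by
  obtain ⟨N, hN⟩ := exists_adicFiltration_eq_bot 𝒜 hk
  exact exists_totalIntegral (isComoduleAlgebra_coactionHom 𝒜) (piMap_surjective 𝒜)
    (rTensor_piMap_coactionHom 𝒜) (commute_top_of_le_odd le_rfl) (ker_piMap 𝒜) hN

lemma isSubcomodule_adicFiltration_odd (n : ℕ) :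
    IsSubcomodule (coactionHom 𝒜) (adicFiltration (𝒜 1) n) := by
  refine isSubcomodule_adicFiltration (commute_top_of_le_odd le_rfl) ?_ n
  rw [← ker_piMap]
  exact isSubcomodule_ker (rTensor_piMap_coactionHom 𝒜)

/-- The odd part of `A^G`, whose classes modulo `J²` make up `(J/J²)^G`. -/
def oddInvariants : Submodule k A := invariants 𝒜 ⊓ 𝒜 1

variable {𝒜} in
lemma proj_mem_invariants (i : ZMod 2) {a : A} (ha : a ∈ invariants 𝒜) :
    GradedAlgebra.proj 𝒜 i a ∈ invariants 𝒜 := by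
  change GradedAlgebra.proj 𝒜 i a ∈ coinvariants (coactionHom 𝒜)
  rw [mem_coinvariants, coactionHom_proj, mem_coinvariants.1 ha, LinearMap.rTensor_tmul]

lemma adicFiltration_one_inf_invariants_le :
    adicFiltration (𝒜 1) 1 ⊓ invariants 𝒜 ≤ oddInvariants 𝒜 ⊔ adicFiltration (𝒜 1) 2 := by
  rintro a ⟨ha, hinv⟩
  rw [← proj_add_proj 𝒜 a, add_comm]
  exact Submodule.add_mem_sup ⟨proj_mem_invariants 1 hinv, proj_mem 𝒜 1 a⟩
    (proj_zero_mem_adicFiltration_two ha)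

lemma adicFiltration_one_le_oddInvariants_mul_top_sup (hk : ringChar k ≠ 2) :
    adicFiltration (𝒜 1) 1 ≤ oddInvariants 𝒜 * ⊤ ⊔ adicFiltration (𝒜 1) 2 := by
  obtain ⟨φ, hφ, hπφ⟩ := exists_totalIntegral_piMap 𝒜 hk
  refine (adicFiltration_one_le_inf_coinvariants_mul_top_sup (isComoduleAlgebra_coactionHom 𝒜) hφ
    hπφ (rTensor_piMap_coactionHom 𝒜) (commute_top_of_le_odd le_rfl) (ker_piMap 𝒜)).trans
    (sup_le ?_ le_sup_right)
  refine (mul_le_mul_left (adicFiltration_one_inf_invariants_le 𝒜) ⊤).trans_eq ?_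
  rw [Submodule.sup_mul, adicFiltration_mul_top]

lemma adicFiltration_odd_eq (hk : ringChar k ≠ 2) {Θ : Submodule k A} (hΘ : Θ ≤ 𝒜 1)
    (h : oddInvariants 𝒜 ≤ Θ ⊔ adicFiltration (𝒜 1) 2) (n : ℕ) :
    adicFiltration (𝒜 1) n = adicFiltration Θ n := by
  obtain ⟨N, hN⟩ := exists_adicFiltration_eq_bot 𝒜 hk
  refine adicFiltration_eq_of_one_eq (commute_top_of_le_odd le_rfl) (commute_top_of_le_odd hΘ)
    (le_antisymm ?_ ?_) n
  · rw [adicFiltration_one (V := Θ)]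
    refine adicFiltration_one_le_of_le_sup (commute_top_of_le_odd le_rfl) hN
      ((adicFiltration_one_le_oddInvariants_mul_top_sup 𝒜 hk).trans (sup_le ?_ le_sup_right))
    refine (mul_le_mul_left h ⊤).trans_eq ?_
    rw [Submodule.sup_mul, adicFiltration_mul_top]
  · rw [adicFiltration_one, adicFiltration_one]
    exact mul_le_mul_left hΘ ⊤

lemma ker_modSq : LinearMap.ker (modSq 𝒜) = adicFiltration (𝒜 1) 2 := by
  ext a
  exact (Submodule.Quotient.mk_eq_zero _).trans mem_superRadical_mul_superRadical

variable {𝒜} in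
lemma mem_invariantsJModSq {x : A ⧸ (superRadical 𝒜 * superRadical 𝒜)} :
    x ∈ invariantsJModSq 𝒜 ↔ ∃ a ∈ adicFiltration (𝒜 1) 1,
      coactionHom 𝒜 a - a ⊗ₜ 1 ∈ tensorTop (Bquot 𝒜) (adicFiltration (𝒜 1) 2) ∧
        modSq 𝒜 a = x := by
  refine exists_congr fun a => ?_
  rw [← and_assoc, ← mem_superRadical, ← ker_modSq, tensorTop_ker, LinearMap.mem_ker, map_sub,
    sub_eq_zero]
  rfl

lemma map_modSq_oddInvariants (hk : ringChar k ≠ 2) :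
    (oddInvariants 𝒜).map (modSq 𝒜) = invariantsJModSq 𝒜 := by
  refine le_antisymm ?_ fun x hx => ?_
  · rintro _ ⟨a, ⟨hinv, hodd⟩, rfl⟩
    refine mem_invariantsJModSq.2 ⟨a, le_adicFiltration_one hodd, ?_, rfl⟩
    rw [show coactionHom 𝒜 a = a ⊗ₜ 1 from hinv, sub_self]
    exact zero_mem _
  · obtain ⟨a, ha, hinv, rfl⟩ := mem_invariantsJModSq.1 hx
    obtain ⟨φ, hφ, -⟩ := exists_totalIntegral_piMap 𝒜 hk
    obtain ⟨y, hy, z, hz, hyz⟩ := Submodule.mem_sup.1 (adicFiltration_one_inf_invariants_le 𝒜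
      ⟨(isSubcomodule_adicFiltration_odd 𝒜 1).average_mem (φ := φ) (adicFiltration_mul_top 1).le ha,
        average_mem_coinvariants (isComoduleAlgebra_coactionHom 𝒜) hφ a⟩)
    have hay := add_mem (sub_average_mem (isComoduleAlgebra_coactionHom 𝒜) hφ
      (isSubcomodule_adicFiltration_odd 𝒜 2) (adicFiltration_mul_top 2).le hinv) hz
    rw [← hyz, sub_add_eq_sub_sub, sub_add_cancel, ← ker_modSq, LinearMap.mem_ker, map_sub,
      sub_eq_zero] at hay
    exact ⟨y, hy, hay.symm⟩

lemma exists_modSq_section (hk : ringChar k ≠ 2) :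
    ∃ σ : invariantsJModSq 𝒜 →ₗ[k] A, ∀ w, σ w ∈ oddInvariants 𝒜 ∧ modSq 𝒜 (σ w) = w := by
  have hmap (a : oddInvariants 𝒜) : modSq 𝒜 a ∈ invariantsJModSq 𝒜 :=
    map_modSq_oddInvariants 𝒜 hk ▸ Submodule.mem_map_of_mem a.2
  obtain ⟨τ, hτ⟩ := LinearMap.exists_rightInverse_of_surjective
    (((modSq 𝒜).domRestrict (oddInvariants 𝒜)).codRestrict (invariantsJModSq 𝒜) hmap)
    (LinearMap.range_eq_top.2 fun ⟨x, hx⟩ => by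
      obtain ⟨a, ha, rfl⟩ := (map_modSq_oddInvariants 𝒜 hk).ge hx
      exact ⟨⟨a, ha⟩, rfl⟩)
  exact ⟨(oddInvariants 𝒜).subtype ∘ₗ τ, fun w =>
    ⟨(τ w).2, congrArg Subtype.val (LinearMap.congr_fun hτ w)⟩⟩

lemma exists_modSq_retraction (hk : ringChar k ≠ 2) :
    ∃ q : A →ₗ[k] invariantsJModSq 𝒜, (∀ a ∈ oddInvariants 𝒜, (q a : A ⧸ _) = modSq 𝒜 a) ∧
      (∀ a ∈ 𝒜 0, q a = 0) ∧
      ∀ a b, q (a * b) = counit (R := k) b • q a + counit (R := k) a • q b := by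
  obtain ⟨φ, hφ, hπφ⟩ := exists_totalIntegral_piMap 𝒜 hk
  have hfilt := adicFiltration_odd_eq 𝒜 hk (Θ := oddInvariants 𝒜) inf_le_right le_sup_left
  set E := average (coactionHom 𝒜) φ
  have hmem (a : A) : modSq 𝒜 (E (GradedAlgebra.proj 𝒜 1 a)) ∈ invariantsJModSq 𝒜 := by
    refine mem_invariantsJModSq.2 ⟨_, (isSubcomodule_adicFiltration_odd 𝒜 1).average_mem
      (adicFiltration_mul_top 1).le (le_adicFiltration_one (proj_mem 𝒜 1 a)), ?_, rfl⟩
    rw [mem_coinvariants.1 (average_mem_coinvariants (isComoduleAlgebra_coactionHom 𝒜) hφ _),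
      sub_self]
    exact zero_mem _
  have hmul (a b : A) : modSq 𝒜 (E (GradedAlgebra.proj 𝒜 1 a * GradedAlgebra.proj 𝒜 0 b)) =
      counit (R := k) b • modSq 𝒜 (E (GradedAlgebra.proj 𝒜 1 a)) := by
    rw [← map_smul, ← sub_eq_zero, ← map_sub, ← LinearMap.mem_ker, ker_modSq, hfilt,
      ← counit_proj_zero 𝒜 b, ← counit_piMap 𝒜]
    exact average_mul_sub_smul_mem hπφ (rTensor_piMap_coactionHom 𝒜) inf_le_left
      ((ker_piMap 𝒜).trans (hfilt 1)) (hfilt 1 ▸ le_adicFiltration_one (proj_mem 𝒜 1 a)) _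
  refine ⟨LinearMap.codRestrict _ (modSq 𝒜 ∘ₗ E ∘ₗ GradedAlgebra.proj 𝒜 1) hmem,
    fun a ha => ?_, fun a ha => Subtype.ext ?_, fun a b => Subtype.ext ?_⟩
  · change modSq 𝒜 (E (GradedAlgebra.proj 𝒜 1 a)) = _
    rw [proj_of_mem ha.2, average_of_mem_coinvariants (isComoduleAlgebra_coactionHom 𝒜) hφ ha.1]
  · change modSq 𝒜 (E (GradedAlgebra.proj 𝒜 1 a)) = 0
    rw [proj_of_mem_ne ha zero_ne_one, map_zero, map_zero]
  · change modSq 𝒜 (E (GradedAlgebra.proj 𝒜 1 (a * b))) =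
      _ • modSq 𝒜 (E (GradedAlgebra.proj 𝒜 1 a)) + _ • modSq 𝒜 (E (GradedAlgebra.proj 𝒜 1 b))
    rw [proj_one_mul, even_mul_comm (proj_mem 𝒜 0 a), add_comm, map_add, map_add, hmul, hmul]

lemma exists_oddPointDer_equiv_dual (hk : ringChar k ≠ 2) :
    ∃ (σ : invariantsJModSq 𝒜 →ₗ[k] A)
      (e : oddPointDer 𝒜 ≃ₗ[k] Module.Dual k (invariantsJModSq 𝒜)),
      (∀ w, σ w ∈ oddInvariants 𝒜 ∧ modSq 𝒜 (σ w) = w) ∧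
        ∀ (δ : oddPointDer 𝒜) w, e δ w = (δ : A →ₗ[k] k) (σ w) := by
  obtain ⟨σ, hσ⟩ := exists_modSq_section 𝒜 hk
  obtain ⟨q, hq, hqeven, hqmul⟩ := exists_modSq_retraction 𝒜 hk
  have hrange : LinearMap.range σ ≤ 𝒜 1 := by
    rintro _ ⟨w, rfl⟩
    exact (hσ w).1.2
  have hgen : oddInvariants 𝒜 ≤ LinearMap.range σ ⊔ adicFiltration (𝒜 1) 2 := fun a ha => by
    rw [← add_sub_cancel (σ ⟨modSq 𝒜 a, map_modSq_oddInvariants 𝒜 hk ▸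
      Submodule.mem_map_of_mem ha⟩) a]
    refine Submodule.add_mem_sup (LinearMap.mem_range_self _ _) ?_
    rw [← ker_modSq, LinearMap.mem_ker, map_sub, (hσ _).2, sub_self]
  refine ⟨σ, LinearEquiv.ofBijective (LinearMap.lcomp k k σ ∘ₗ (oddPointDer 𝒜).subtype)
    ⟨(injective_iff_map_eq_zero _).2 fun δ hδ => Subtype.ext ?_, fun ℓ =>
      ⟨⟨ℓ ∘ₗ q, fun a ha => ?_, fun a b => ?_⟩, LinearMap.ext fun w => congrArg ℓ ?_⟩⟩,
    hσ, fun δ w => rfl⟩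
  · refine oddPointDer_eq_zero_of_forall_mem δ.2 hrange ?_ ?_
    · rw [← adicFiltration_one, ← adicFiltration_odd_eq 𝒜 hk hrange hgen]
      exact le_sup_left
    · rintro _ ⟨w, rfl⟩
      exact LinearMap.congr_fun hδ w
  · rw [LinearMap.comp_apply, hqeven a ha, map_zero]
  · simp only [LinearMap.comp_apply, hqmul, map_add, map_smul, smul_eq_mul]
    ring
  · exact Subtype.ext ((hq _ (hσ w).1).trans (hσ w).2)

lemma exists_isAdapted (hk : ringChar k ≠ 2) {s : ℕ} (hs : s = Module.finrank k (gMinus 𝒜)) :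
    ∃ (θ : Fin s → A) (D' : Fin s → A →ₗ[k] A), IsAdapted 𝒜 θ D' := by
  obtain ⟨σ, e, hσ, he⟩ := exists_oddPointDer_equiv_dual 𝒜 hk
  have := finite_oddPointDer 𝒜
  have : Module.Finite k (invariantsJModSq 𝒜) :=
    (Module.finite_dual_iff k).1 (Module.Finite.equiv e)
  have hfinrank : Module.finrank k (invariantsJModSq 𝒜) = s := by
    rw [hs, (gMinusEquiv 𝒜).finrank_eq, e.finrank_eq, Subspace.dual_finrank_eq]
  let b := Module.finBasisOfFinrankEq k (invariantsJModSq 𝒜) hfinrank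
  have hb : (fun i => modSq 𝒜 (σ (b i))) = (invariantsJModSq 𝒜).subtype ∘ b :=
    funext fun i => (hσ (b i)).2
  refine ⟨fun i => σ (b i), fun i => rightInvOp (e.symm (b.coord i)).1,
    fun i => (hσ _).1.2, fun i => (hσ _).1.1, ?_, ?_,
    fun i => isOddRightInvariant_rightInvOp (e.symm (b.coord i)).2, fun i j => ?_⟩
  · rw [hb]
    exact b.linearIndependent.map' _ (Submodule.ker_subtype _)
  · rw [hb, Set.range_comp, Submodule.span_image, b.span_eq, Submodule.map_subtype_top]
  · rw [counit_rightInvOp, ← he, LinearEquiv.apply_symm_apply, b.coord_apply,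
      b.repr_self, Finsupp.single_apply]
    simp only [eq_comm]

end Existence

lemma eulerDerivation_apply {k A : Type*} [Field k] [Ring A] [Algebra k A] {s : ℕ} (θ : Fin s → A)
    (D' : Fin s → A →ₗ[k] A) (a : A) : eulerDerivation θ D' a = ∑ i, θ i * D' i a := by
  simp [eulerDerivation]

section RightInvariant

open Coalgebra

variable {k A : Type*} [Field k] [Ring A] [Algebra k A]
  {𝒜 : ZMod 2 → Submodule k A} [GradedAlgebra 𝒜] {D : A →ₗ[k] A}

section SuperDerivation

variable (hD : D ∈ oddSuperDer 𝒜)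
include hD

lemma oddSuperDer_one : D 1 = 0 := by
  simpa [parity_of_even (SetLike.one_mem_graded 𝒜)] using hD.2 1 1

lemma oddSuperDer_odd_mul {o : A} (ho : o ∈ 𝒜 1) (b : A) : D (o * b) = D o * b - o * D b := by
  rw [hD.2, parity_of_odd ho, neg_mul, sub_eq_add_neg]

lemma oddSuperDer_mem_adicFiltration [IsSuperCommutative 𝒜] {n : ℕ} {a : A}
    (ha : a ∈ adicFiltration (𝒜 1) (n + 1)) : D a ∈ adicFiltration (𝒜 1) n := by
  induction n generalizing a with
  | zero => rw [adicFiltration_zero]; exact Submodule.mem_top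
  | succ n ih =>
    rw [adicFiltration_succ] at ha
    induction ha using Submodule.mul_induction_on' with
    | add x _ y _ hx hy => rw [map_add]; exact add_mem hx hy
    | mem_mul_mem o ho b hb =>
      rw [oddSuperDer_odd_mul hD ho]
      refine sub_mem (mul_mem_adicFiltration_left (commute_top_of_le_odd le_rfl) _ hb) ?_
      rw [adicFiltration_succ]
      exact Submodule.mul_mem_mul ho (ih hb)

end SuperDerivation

variable [Coalgebra k A] [IsSuperAffineHopfAlgebra 𝒜]

lemma coactionHom_rightInvariant (hD : IsOddRightInvariant 𝒜 D) (a : A) :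
    coactionHom 𝒜 (D a) = D.rTensor (Bquot 𝒜) (coactionHom 𝒜 a) := by
  rw [coactionHom_apply, coactionHom_apply, ← LinearMap.comp_apply (LinearMap.rTensor _ _),
    LinearMap.rTensor_comp_lTensor, ← LinearMap.lTensor_comp_rTensor, LinearMap.comp_apply]
  exact congrArg _ (LinearMap.congr_fun hD.2 a)

lemma piMap_of_mem_invariants {a : A} (ha : a ∈ invariants 𝒜) :
    piMap 𝒜 a = algebraMap k (Bquot 𝒜) (counit (R := k) a) := by
  have h := rTensor_counit_comul (R := k) (piMap 𝒜 a)
  rw [← rTensor_piMap_coactionHom, show coactionHom 𝒜 a = a ⊗ₜ 1 from ha] at h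
  simpa [Algebra.algebraMap_eq_smul_one, counit_piMap] using
    (congrArg (TensorProduct.lid k (Bquot 𝒜)) h).symm

lemma sub_algebraMap_counit_mem {a : A} (ha : a ∈ invariants 𝒜) :
    a - algebraMap k A (counit (R := k) a) ∈ adicFiltration (𝒜 1) 1 := by
  rw [← ker_piMap, LinearMap.mem_ker, AlgHom.toLinearMap_apply, map_sub,
    piMap_of_mem_invariants ha, AlgHom.commutes, sub_self]

end RightInvariant

section Adapted

open Coalgebra

variable {k A : Type*} [Field k] [Ring A] [Algebra k A]
  {𝒜 : ZMod 2 → Submodule k A} [GradedAlgebra 𝒜] [Coalgebra k A] [IsSuperAffineHopfAlgebra 𝒜]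
  {s : ℕ} {θ : Fin s → A} {D' : Fin s → A →ₗ[k] A}

namespace IsAdapted

variable (h : IsAdapted 𝒜 θ D')
include h

lemma linearCombination_odd (v : Fin s → k) : Fintype.linearCombination k θ v ∈ 𝒜 1 := by
  rw [Fintype.linearCombination_apply]
  exact sum_mem fun i _ => Submodule.smul_mem _ _ (h.odd i)

lemma linearCombination_invariant (v : Fin s → k) :
    Fintype.linearCombination k θ v ∈ invariants 𝒜 := by
  rw [Fintype.linearCombination_apply]
  exact sum_mem fun i _ => Submodule.smul_mem _ _ (h.invariant i)

lemma adicFiltration_odd_eq (hk : ringChar k ≠ 2) (n : ℕ) :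
    adicFiltration (𝒜 1) n =
      adicFiltration (LinearMap.range (Fintype.linearCombination k θ)) n := by
  refine SuperHopf.adicFiltration_odd_eq 𝒜 hk ?_ (fun a ha => ?_) n
  · rintro _ ⟨v, rfl⟩
    exact h.linearCombination_odd v
  · have hspan : modSq 𝒜 a ∈ Submodule.span k (Set.range fun i => modSq 𝒜 (θ i)) := by
      rw [h.span_eq, ← map_modSq_oddInvariants 𝒜 hk]
      exact Submodule.mem_map_of_mem ha
    obtain ⟨c, hc⟩ := (Submodule.mem_span_range_iff_exists_fun k).1 hspan
    rw [← add_sub_cancel (Fintype.linearCombination k θ c) a]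
    refine Submodule.add_mem_sup (LinearMap.mem_range_self _ c) ?_
    rw [← ker_modSq, LinearMap.mem_ker, map_sub, ← hc, Fintype.linearCombination_apply, map_sum]
    simp only [map_smul, sub_self]

lemma adicFiltration_range_eq_bot (hk : ringChar k ≠ 2) :
    adicFiltration (LinearMap.range (Fintype.linearCombination k θ)) (s + 1) = ⊥ := by
  rw [adicFiltration, range_pow_eq_bot_of_odd hk _ h.linearCombination_odd (by simp),
    Submodule.bot_mul]

lemma adicFiltration_odd_eq_bot (hk : ringChar k ≠ 2) : adicFiltration (𝒜 1) (s + 1) = ⊥ := by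
  rw [h.adicFiltration_odd_eq hk, h.adicFiltration_range_eq_bot hk]

lemma apply_linearCombination_sub_mem (i : Fin s) (v : Fin s → k) :
    D' i (Fintype.linearCombination k θ v) - algebraMap k A (v i) ∈ adicFiltration (𝒜 1) 1 := by
  have hinv : D' i (Fintype.linearCombination k θ v) ∈ invariants 𝒜 := by
    change coactionHom 𝒜 _ = _
    rw [coactionHom_rightInvariant (h.rightInvariant i),
      show coactionHom 𝒜 _ = _ ⊗ₜ 1 from h.linearCombination_invariant v, LinearMap.rTensor_tmul]
    rfl
  have hcounit : counit (R := k) (D' i (Fintype.linearCombination k θ v)) = v i := by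
    simp [Fintype.linearCombination_apply, h.dual]
  exact hcounit ▸ sub_algebraMap_counit_mem hinv

lemma euler_mul (a b : A) : eulerDerivation θ D' (a * b) =
    eulerDerivation θ D' a * b + a * eulerDerivation θ D' b := by
  simp only [eulerDerivation_apply, Finset.sum_mul, Finset.mul_sum, ← Finset.sum_add_distrib]
  refine Finset.sum_congr rfl fun i _ => ?_
  rw [(h.rightInvariant i).1.2, mul_add, ← mul_assoc, ← mul_assoc, ← mul_odd (h.odd i),
    mul_assoc a]

lemma euler_mem {i : ZMod 2} {a : A} (ha : a ∈ 𝒜 i) : eulerDerivation θ D' a ∈ 𝒜 i := by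
  rw [eulerDerivation_apply]
  refine sum_mem fun j _ => ?_
  have hmem := SetLike.mul_mem_graded (h.odd j) ((h.rightInvariant j).1.1 i a ha)
  rwa [add_left_comm, CharTwo.add_self_eq_zero, add_zero] at hmem

lemma euler_proj (i : ZMod 2) (a : A) : eulerDerivation θ D' (GradedAlgebra.proj 𝒜 i a) =
    GradedAlgebra.proj 𝒜 i (eulerDerivation θ D' a) := by
  induction a using homogeneous_induction (𝒜 := 𝒜) with
  | hadd x y hx hy => simp only [map_add, hx, hy]
  | h j a ha =>
    rcases eq_or_ne j i with rfl | hij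
    · rw [proj_of_mem ha, proj_of_mem (h.euler_mem ha)]
    · rw [proj_of_mem_ne ha hij, proj_of_mem_ne (h.euler_mem ha) hij, map_zero]

lemma euler_linearCombination_sub_mem (v : Fin s → k) :
    eulerDerivation θ D' (Fintype.linearCombination k θ v) - Fintype.linearCombination k θ v ∈
      adicFiltration (𝒜 1) 2 := by
  rw [eulerDerivation_apply]
  nth_rw 2 [Fintype.linearCombination_apply]
  rw [← Finset.sum_sub_distrib]
  refine sum_mem fun i _ => ?_
  rw [Algebra.smul_def, Algebra.commutes, ← mul_sub, adicFiltration_succ]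
  exact Submodule.mul_mem_mul (h.odd i) (h.apply_linearCombination_sub_mem i v)

lemma euler_sub_smul_mem (hk : ringChar k ≠ 2) (n : ℕ) (a : A) (ha : a ∈ adicFiltration (𝒜 1) n) :
    eulerDerivation θ D' a - (n : k) • a ∈ adicFiltration (𝒜 1) (n + 1) := by
  induction n generalizing a with
  | zero =>
    rw [Nat.cast_zero, zero_smul, sub_zero, eulerDerivation_apply]
    exact sum_mem fun i _ => mul_mem_adicFiltration_right (le_adicFiltration_one (h.odd i)) _
  | succ n ih =>
    rw [h.adicFiltration_odd_eq hk, adicFiltration_succ, ← h.adicFiltration_odd_eq hk] at ha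
    induction ha using Submodule.mul_induction_on' with
    | add x _ y _ hx hy =>
      rw [map_add, smul_add, add_sub_add_comm]
      exact add_mem hx hy
    | mem_mul_mem o ho b hb =>
      obtain ⟨v, rfl⟩ := ho
      set o := Fintype.linearCombination k θ v
      have hleibniz : eulerDerivation θ D' (o * b) - ((n + 1 : ℕ) : k) • (o * b) =
          (eulerDerivation θ D' o - o) * b + o * (eulerDerivation θ D' b - (n : k) • b) := by
        rw [h.euler_mul, Nat.cast_succ, add_smul, one_smul, mul_sub, sub_mul, mul_smul_comm]
        abel
      rw [hleibniz]
      refine add_mem ?_ ?_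
      · rw [add_comm n, add_right_comm 1 n 1]
        exact mul_mem_adicFiltration (commute_top_of_le_odd le_rfl)
          (h.euler_linearCombination_sub_mem v) hb
      · rw [adicFiltration_succ]
        exact Submodule.mul_mem_mul (h.linearCombination_odd v) (ih b hb)

lemma coactionHom_euler (a : A) : coactionHom 𝒜 (eulerDerivation θ D' a) =
    (eulerDerivation θ D').rTensor (Bquot 𝒜) (coactionHom 𝒜 a) := by
  have hterm (i : Fin s) : coactionHom 𝒜 (θ i * D' i a) =
      (LinearMap.mulLeft k (θ i) ∘ₗ D' i).rTensor (Bquot 𝒜) (coactionHom 𝒜 a) := by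
    rw [map_mul, show coactionHom 𝒜 (θ i) = θ i ⊗ₜ 1 from h.invariant i,
      coactionHom_rightInvariant (h.rightInvariant i)]
    induction coactionHom 𝒜 a with
    | zero => simp
    | add x y hx hy => simp only [map_add, mul_add, hx, hy]
    | tmul x y => simp
  rw [eulerDerivation_apply, map_sum, Finset.sum_congr rfl fun i _ => hterm i,
    ← LinearMap.sum_apply]
  exact LinearMap.congr_fun (map_sum (LinearMap.rTensorHom (R := k) (Bquot 𝒜)) _ _).symm _

/-- The subalgebra `B̃ = ker D` of `A`. -/
def kerEuler : Subalgebra k A :=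
  (LinearMap.ker (eulerDerivation θ D')).toSubalgebra
    (by simp [eulerDerivation_apply, oddSuperDer_one (h.rightInvariant _).1])
    fun a b ha hb => by
      rw [LinearMap.mem_ker] at ha hb ⊢
      rw [h.euler_mul, ha, hb, zero_mul, mul_zero, add_zero]

lemma proj_mem_kerEuler (i : ZMod 2) {a : A} (ha : a ∈ h.kerEuler) :
    GradedAlgebra.proj 𝒜 i a ∈ h.kerEuler := by
  change eulerDerivation θ D' _ = 0
  rw [h.euler_proj, show eulerDerivation θ D' a = 0 from ha, map_zero]

section Splitting

variable (hk : ringChar k ≠ 2) (hchar : ∀ n, 0 < n → n ≤ s → (n : k) ≠ 0)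
include hk hchar

lemma isCompl_kerEuler :
    IsCompl (Subalgebra.toSubmodule h.kerEuler) (adicFiltration (𝒜 1) 1) where
  disjoint := disjoint_ker_of_apply_sub_smul_mem (h.adicFiltration_odd_eq_bot hk)
    (h.euler_sub_smul_mem hk) hchar
  codisjoint := codisjoint_ker_of_apply_sub_smul_mem adicFiltration_zero
    (h.adicFiltration_odd_eq_bot hk) (h.euler_sub_smul_mem hk) hchar

lemma kerEuler_le_even : Subalgebra.toSubmodule h.kerEuler ≤ 𝒜 0 := fun a ha => by
  have hodd : GradedAlgebra.proj 𝒜 1 a = 0 :=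
    Submodule.disjoint_def.1 (h.isCompl_kerEuler hk hchar).disjoint _ (h.proj_mem_kerEuler 1 ha)
      (le_adicFiltration_one (proj_mem 𝒜 1 a))
  rw [← proj_add_proj 𝒜 a, hodd, add_zero]
  exact proj_mem 𝒜 0 a

lemma bijective_piMap_kerEuler : Function.Bijective ((piMap 𝒜).comp h.kerEuler.val) := by
  have hcompl := h.isCompl_kerEuler hk hchar
  rw [← ker_piMap] at hcompl
  constructor
  · exact (injective_iff_map_eq_zero _).2 fun a ha =>
      Subtype.ext (Submodule.disjoint_def.1 hcompl.disjoint a a.2 ha)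
  · intro b
    obtain ⟨a, rfl⟩ := piMap_surjective 𝒜 b
    obtain ⟨x, hx, y, hy, rfl⟩ := Submodule.mem_sup.1
      (hcompl.sup_eq_top.ge (Submodule.mem_top (x := a)))
    exact ⟨⟨x, hx⟩, by simpa using LinearMap.mem_ker.1 hy⟩

/-- The isomorphism `B̃ ≅ B` induced by `π`. -/
def kerEulerEquiv : h.kerEuler ≃ₐ[k] Bquot 𝒜 :=
  AlgEquiv.ofBijective _ (h.bijective_piMap_kerEuler hk hchar)

/-- The inclusion of `B ≅ B̃` into `A`, a splitting of `π` as a homomorphism of algebras. -/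
def splitting : Bquot 𝒜 →ₐ[k] A :=
  h.kerEuler.val.comp (h.kerEulerEquiv hk hchar).symm.toAlgHom

lemma range_splitting :
    LinearMap.range (h.splitting hk hchar).toLinearMap = Subalgebra.toSubmodule h.kerEuler := by
  refine le_antisymm ?_ fun a ha => ⟨h.kerEulerEquiv hk hchar ⟨a, ha⟩, ?_⟩
  · rintro _ ⟨b, rfl⟩
    exact ((h.kerEulerEquiv hk hchar).symm b).2
  · exact congrArg Subtype.val ((h.kerEulerEquiv hk hchar).symm_apply_apply ⟨a, ha⟩)

lemma isTotalIntegral_splitting :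
    IsTotalIntegral (coactionHom 𝒜) (h.splitting hk hchar).toLinearMap := by
  refine isTotalIntegral_of_isSubcomodule_range (map_one (h.splitting hk hchar))
    (h.kerEulerEquiv hk hchar).apply_symm_apply (rTensor_piMap_coactionHom 𝒜) ?_
  rw [h.range_splitting]
  exact isSubcomodule_ker_of_colinear h.coactionHom_euler

end Splitting

end IsAdapted

end Adapted

section SuperPoly

variable {k : Type*} [Field k] {s n : ℕ}

/-- The filtration of the superpolynomial ring by the powers of the ideal of the variables. -/
abbrev polyFiltration (k : Type*) [Field k] (s : ℕ) : ℕ → Submodule k (SuperPoly k s) :=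
  adicFiltration (LinearMap.range (ExteriorAlgebra.ι k))

lemma ι_mul_mem_polyFiltration (v : Fin s → k) {x : SuperPoly k s}
    (hx : x ∈ polyFiltration k s n) :
    ExteriorAlgebra.ι k v * x ∈ polyFiltration k s (n + 1) := by
  rw [polyFiltration, adicFiltration_succ]
  exact Submodule.mul_mem_mul (LinearMap.mem_range_self _ v) hx

@[elab_as_elim]
lemma polyFiltration_induction {P : SuperPoly k s → Prop} {x : SuperPoly k s}
    (hx : x ∈ polyFiltration k s (n + 1)) (hadd : ∀ x y, P x → P y → P (x + y))
    (hι_mul : ∀ v, ∀ y ∈ polyFiltration k s n, P (ExteriorAlgebra.ι k v * y)) : P x := by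
  rw [polyFiltration, adicFiltration_succ] at hx
  refine Submodule.mul_induction_on hx ?_ hadd
  rintro _ ⟨v, rfl⟩ y hy
  exact hι_mul v y hy

lemma polyFiltration_eq_bot : polyFiltration k s (s + 1) = ⊥ := by
  rw [polyFiltration, adicFiltration, range_ι_pow_eq_bot k _ (by simp), Submodule.bot_mul]

lemma exists_sub_algebraMap_mem_polyFiltration (x : SuperPoly k s) :
    ∃ r : k, x - algebraMap k _ r ∈ polyFiltration k s 1 := by
  induction x using CliffordAlgebra.left_induction with
  | algebraMap r => exact ⟨r, by simp⟩
  | add x y hx hy =>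
    obtain ⟨r, hr⟩ := hx
    obtain ⟨t, ht⟩ := hy
    exact ⟨r + t, by rw [map_add, add_sub_add_comm]; exact add_mem hr ht⟩
  | ι_mul x v _ =>
    refine ⟨0, ?_⟩
    rw [map_zero, sub_zero]
    exact ι_mul_mem_polyFiltration v (n := 0) (by rw [polyFiltration, adicFiltration_zero]; trivial)

/-- The odd partial derivative `∂/∂θᵢ` of the superpolynomial ring. -/
def polyDer (i : Fin s) : SuperPoly k s →ₗ[k] SuperPoly k s :=
  CliffordAlgebra.contractLeft (Q := (0 : QuadraticForm k (Fin s → k))) (LinearMap.proj i)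

lemma polyDer_ι_mul (i : Fin s) (v : Fin s → k) (x : SuperPoly k s) :
    polyDer i (ExteriorAlgebra.ι k v * x) = v i • x - ExteriorAlgebra.ι k v * polyDer i x :=
  CliffordAlgebra.contractLeft_ι_mul _ _ _

lemma sum_smul_superPolyVar (v : Fin s → k) :
    ∑ i, v i • superPolyVar k i = ExteriorAlgebra.ι k v := by
  conv_rhs => rw [pi_eq_sum_univ' v, map_sum]
  simp only [map_smul, superPolyVar]

lemma eulerDerivation_superPoly_ι_mul (v : Fin s → k) (x : SuperPoly k s) :
    eulerDerivation (superPolyVar k) polyDer (ExteriorAlgebra.ι k v * x) =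
      ExteriorAlgebra.ι k v * x +
        ExteriorAlgebra.ι k v * eulerDerivation (superPolyVar k) polyDer x := by
  have hterm (i : Fin s) : superPolyVar k i * polyDer i (ExteriorAlgebra.ι k v * x) =
      (v i • superPolyVar k i) * x +
        ExteriorAlgebra.ι k v * (superPolyVar k i * polyDer i x) := by
    have hswap : superPolyVar k i * ExteriorAlgebra.ι k v =
        -(ExteriorAlgebra.ι k v * superPolyVar k i) :=
      eq_neg_of_add_eq_zero_left (ExteriorAlgebra.ι_add_mul_swap _ _)
    rw [polyDer_ι_mul, mul_sub, mul_smul_comm, smul_mul_assoc, ← mul_assoc, hswap, neg_mul,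
      sub_neg_eq_add, mul_assoc]
  simp only [eulerDerivation_apply, hterm, Finset.sum_add_distrib, ← Finset.sum_mul,
    ← Finset.mul_sum, sum_smul_superPolyVar]

lemma eulerDerivation_superPoly_sub_smul_mem {x : SuperPoly k s}
    (hx : x ∈ polyFiltration k s n) :
    eulerDerivation (superPolyVar k) polyDer x - (n : k) • x ∈ polyFiltration k s (n + 1) := by
  induction n generalizing x with
  | zero =>
    rw [Nat.cast_zero, zero_smul, sub_zero, eulerDerivation_apply]
    exact sum_mem fun i _ => ι_mul_mem_polyFiltration _ (n := 0)
      (by rw [polyFiltration, adicFiltration_zero]; exact Submodule.mem_top)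
  | succ n ih =>
    refine polyFiltration_induction hx (fun x y hx hy => ?_) fun v y hy => ?_
    · rw [map_add, smul_add, add_sub_add_comm]
      exact add_mem hx hy
    · convert ι_mul_mem_polyFiltration v (ih hy) using 1
      rw [eulerDerivation_superPoly_ι_mul, Nat.cast_succ, add_smul, one_smul, mul_sub,
        mul_smul_comm]
      abel

end SuperPoly

section Adapted

open Coalgebra

variable {k A : Type*} [Field k] [Ring A] [Algebra k A]
  {𝒜 : ZMod 2 → Submodule k A} [GradedAlgebra 𝒜] [Coalgebra k A] [IsSuperAffineHopfAlgebra 𝒜]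
  {s n : ℕ} {θ : Fin s → A} {D' : Fin s → A →ₗ[k] A}

namespace IsAdapted

variable (h : IsAdapted 𝒜 θ D') (hk : ringChar k ≠ 2)

/-- The homomorphism from the superpolynomial ring to `A` sending the `i`-th variable to `θ i`. -/
def polyHom : SuperPoly k s →ₐ[k] A :=
  exteriorLift hk (Fintype.linearCombination k θ) h.linearCombination_odd

lemma polyHom_ι (v : Fin s → k) :
    h.polyHom hk (ExteriorAlgebra.ι k v) = Fintype.linearCombination k θ v :=
  exteriorLift_ι hk _ _ v

lemma polyHom_superPolyVar (i : Fin s) : h.polyHom hk (superPolyVar k i) = θ i := by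
  rw [superPolyVar, polyHom_ι, Fintype.linearCombination_apply_single, one_smul]

lemma polyHom_mem_adicFiltration {x : SuperPoly k s} (hx : x ∈ polyFiltration k s n) :
    h.polyHom hk x ∈ adicFiltration (𝒜 1) n := by
  induction n generalizing x with
  | zero => rw [adicFiltration_zero]; exact Submodule.mem_top
  | succ n ih =>
    refine polyFiltration_induction hx (fun x y hx hy => ?_) fun v y hy => ?_
    · rw [map_add]; exact add_mem hx hy
    · rw [map_mul, polyHom_ι, adicFiltration_succ]
      exact Submodule.mul_mem_mul (h.linearCombination_odd v) (ih hy)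

lemma apply_polyHom_sub_mem (i : Fin s) {x : SuperPoly k s} (hx : x ∈ polyFiltration k s n) :
    D' i (h.polyHom hk x) - h.polyHom hk (polyDer i x) ∈ adicFiltration (𝒜 1) n := by
  induction n generalizing x with
  | zero => rw [adicFiltration_zero]; exact Submodule.mem_top
  | succ n ih =>
    refine polyFiltration_induction hx (fun x y hx hy => ?_) fun v y hy => ?_
    · simp only [map_add, add_sub_add_comm]
      exact add_mem hx hy
    · set o := Fintype.linearCombination k θ v with ho
      have hleibniz : D' i (o * h.polyHom hk y) -
          h.polyHom hk (v i • y - ExteriorAlgebra.ι k v * polyDer i y) =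
          (D' i o - algebraMap k A (v i)) * h.polyHom hk y -
            o * (D' i (h.polyHom hk y) - h.polyHom hk (polyDer i y)) := by
        rw [oddSuperDer_odd_mul (h.rightInvariant i).1 (h.linearCombination_odd v), map_sub,
          map_smul, map_mul, polyHom_ι, ← ho, sub_mul, mul_sub, Algebra.smul_def]
        abel
      rw [polyDer_ι_mul, map_mul, polyHom_ι, ← ho, hleibniz]
      refine sub_mem ?_ ?_
      · rw [add_comm n]
        exact mul_mem_adicFiltration (commute_top_of_le_odd le_rfl)
          (h.apply_linearCombination_sub_mem i v) (h.polyHom_mem_adicFiltration hk hy)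
      · rw [adicFiltration_succ]
        exact Submodule.mul_mem_mul (h.linearCombination_odd v) (ih hy)

lemma mem_polyFiltration_one_of_polyHom_mem {x : SuperPoly k s}
    (hx : h.polyHom hk x ∈ adicFiltration (𝒜 1) 1) : x ∈ polyFiltration k s 1 := by
  obtain ⟨r, hr⟩ := exists_sub_algebraMap_mem_polyFiltration x
  have hcounit := counit_eq_zero_of_mem_adicFiltration_one
    (sub_mem hx (h.polyHom_mem_adicFiltration hk hr))
  rw [← map_sub, sub_sub_cancel, AlgHom.commutes, Algebra.algebraMap_eq_smul_one, map_smul,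
    IsSuperAffineHopfAlgebra.counit_one 𝒜, smul_eq_mul, mul_one] at hcounit
  rwa [hcounit, map_zero, sub_zero] at hr

lemma polyHom_mem_coinvariants (x : SuperPoly k s) :
    h.polyHom hk x ∈ coinvariants (coactionHom 𝒜) := by
  induction x using CliffordAlgebra.left_induction with
  | algebraMap r => rw [AlgHom.commutes]; exact Subalgebra.algebraMap_mem _ r
  | add x y hx hy => rw [map_add]; exact add_mem hx hy
  | ι_mul x v hx =>
    rw [map_mul]
    refine mul_mem ?_ hx
    exact (h.polyHom_ι hk v).symm ▸ h.linearCombination_invariant v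

lemma range_polyHom : (h.polyHom hk).range = coinvariants (coactionHom 𝒜) := by
  refine le_antisymm ?_ ?_
  · rintro _ ⟨x, rfl⟩
    exact h.polyHom_mem_coinvariants hk x
  · obtain ⟨φ, hφ, hπφ⟩ := exists_totalIntegral_piMap 𝒜 hk
    refine (coinvariants_le_adjoin (isComoduleAlgebra_coactionHom 𝒜) hφ hπφ
      (rTensor_piMap_coactionHom 𝒜) ?_ ((ker_piMap 𝒜).trans (h.adicFiltration_odd_eq hk 1))
      (h.adicFiltration_range_eq_bot hk)).trans (Algebra.adjoin_le ?_)
    · rintro _ ⟨v, rfl⟩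
      exact h.linearCombination_invariant v
    · rintro _ ⟨v, rfl⟩
      exact ⟨ExteriorAlgebra.ι k v, h.polyHom_ι hk v⟩

variable (hchar : ∀ n, 0 < n → n ≤ s → (n : k) ≠ 0)
include hk hchar

/-- If `f(θ)` has order `n + 1`, then `D'ᵢ (f(θ))` has order `n`, and so, by induction, has the
formal derivative of `f` that it agrees with to leading order. Hence the formal Euler operator
sends `f` to order `n + 1`; to leading order it is multiplication by `n`. -/
lemma mem_polyFiltration_of_polyHom_mem (hn : n ≤ s + 1) {x : SuperPoly k s}
    (hx : h.polyHom hk x ∈ adicFiltration (𝒜 1) n) : x ∈ polyFiltration k s n := by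
  induction n generalizing x with
  | zero => rw [polyFiltration, adicFiltration_zero]; exact Submodule.mem_top
  | succ n ih =>
    rcases Nat.eq_zero_or_pos n with rfl | hpos
    · exact h.mem_polyFiltration_one_of_polyHom_mem hk hx
    have hxn : x ∈ polyFiltration k s n :=
      ih (by lia) (adicFiltration_antitone (commute_top_of_le_odd le_rfl) n.le_succ hx)
    have hder (i : Fin s) : polyDer i x ∈ polyFiltration k s n := by
      refine ih (by lia) ?_
      simpa using sub_mem (oddSuperDer_mem_adicFiltration (h.rightInvariant i).1 hx)
        (h.apply_polyHom_sub_mem hk i hxn)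
    have heuler : eulerDerivation (superPolyVar k) polyDer x ∈ polyFiltration k s (n + 1) := by
      rw [eulerDerivation_apply]
      exact sum_mem fun i _ => ι_mul_mem_polyFiltration _ (hder i)
    have hsmul := sub_mem heuler (eulerDerivation_superPoly_sub_smul_mem hxn)
    rw [sub_sub_cancel] at hsmul
    exact (Submodule.smul_mem_iff _ (hchar n hpos (by lia))).1 hsmul

lemma polyHom_injective : Function.Injective (h.polyHom hk) := by
  refine (injective_iff_map_eq_zero _).2 fun x hx => ?_
  rw [← Submodule.mem_bot k, ← polyFiltration_eq_bot]
  exact h.mem_polyFiltration_of_polyHom_mem hk hchar le_rfl (hx ▸ zero_mem _)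

/-- The isomorphism `k[θ₁, …, θₛ] ≅ A^G`. -/
def polyEquiv : SuperPoly k s ≃ₐ[k] coinvariants (coactionHom 𝒜) :=
  (AlgEquiv.ofInjective _ (h.polyHom_injective hk hchar)).trans
    (Subalgebra.equivOfEq _ _ (h.range_polyHom hk))

theorem bijective_coinvariants_mul_kerEuler : Function.Bijective (LinearMap.mul' k A ∘ₗ
    TensorProduct.map (coinvariants (coactionHom 𝒜)).val.toLinearMap
      h.kerEuler.val.toLinearMap) := by
  have hfactor : LinearMap.mul' k A ∘ₗ TensorProduct.map
      (coinvariants (coactionHom 𝒜)).val.toLinearMap h.kerEuler.val.toLinearMap =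
      (LinearMap.mul' k A ∘ₗ TensorProduct.map (coinvariants (coactionHom 𝒜)).val.toLinearMap
        (h.splitting hk hchar).toLinearMap) ∘ₗ
      (TensorProduct.congr (LinearEquiv.refl k _)
        (h.kerEulerEquiv hk hchar).toLinearEquiv).toLinearMap :=
    TensorProduct.ext' fun x b => by simp [splitting]
  rw [hfactor, LinearMap.coe_comp]
  exact (bijective_coinvariants_mul (isComoduleAlgebra_coactionHom 𝒜)
    (h.isTotalIntegral_splitting hk hchar)).comp (LinearEquiv.bijective _)

lemma bijective_polyHom_mul_kerEuler : Function.Bijective (LinearMap.mul' k A ∘ₗ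
    TensorProduct.map (h.polyHom hk).toLinearMap h.kerEuler.val.toLinearMap) := by
  have hfactor : LinearMap.mul' k A ∘ₗ
      TensorProduct.map (h.polyHom hk).toLinearMap h.kerEuler.val.toLinearMap =
      (LinearMap.mul' k A ∘ₗ TensorProduct.map (coinvariants (coactionHom 𝒜)).val.toLinearMap
        h.kerEuler.val.toLinearMap) ∘ₗ
      (TensorProduct.congr (h.polyEquiv hk hchar).toLinearEquiv
        (LinearEquiv.refl k h.kerEuler)).toLinearMap :=
    TensorProduct.ext' fun x b => rfl
  rw [hfactor, LinearMap.coe_comp]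
  exact (h.bijective_coinvariants_mul_kerEuler hk hchar).comp (LinearEquiv.bijective _)

end IsAdapted

end Adapted

section Gradings

variable {k A B C : Type*} [Field k] [Ring A] [Algebra k A] [Ring B] [Algebra k B]
  [Ring C] [Algebra k C]

lemma eq_zero_or_one_of_zmod_two (i : ZMod 2) : i = 0 ∨ i = 1 := by
  decide +revert

lemma isInternal_iff_isCompl_even_odd (𝒜 : ZMod 2 → Submodule k A) :
    DirectSum.IsInternal 𝒜 ↔ IsCompl (𝒜 0) (𝒜 1) :=
  DirectSum.isInternal_submodule_iff_isCompl 𝒜 zero_ne_one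
    (Set.eq_univ_of_forall eq_zero_or_one_of_zmod_two).symm

lemma isCompl_even_odd (𝒜 : ZMod 2 → Submodule k A) [GradedAlgebra 𝒜] :
    IsCompl (𝒜 0) (𝒜 1) :=
  (isInternal_iff_isCompl_even_odd 𝒜).1 (DirectSum.Decomposition.isInternal 𝒜)

lemma isInternal_inducedGrading (𝒜 : ZMod 2 → Submodule k A) [GradedAlgebra 𝒜]
    {S : Subalgebra k A} (hS : ∀ i, ∀ a ∈ S, GradedAlgebra.proj 𝒜 i a ∈ S) :
    DirectSum.IsInternal (inducedGrading 𝒜 S) := by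
  refine (isInternal_iff_isCompl_even_odd _).2 (IsCompl.of_le (fun a ha => Subtype.ext ?_)
    fun a _ => Submodule.mem_sup.2 ⟨⟨_, hS 0 a a.2⟩, proj_mem 𝒜 0 (a : A), ⟨_, hS 1 a a.2⟩,
      proj_mem 𝒜 1 (a : A), Subtype.ext (proj_add_proj 𝒜 (a : A))⟩)
  exact Submodule.disjoint_def.1 (isCompl_even_odd 𝒜).disjoint (a : A) ha.1 ha.2

/-- The grading `inducedGrading 𝒜 S` of a subalgebra `S` containing the homogeneous components of
its elements. -/
abbrev inducedGradedAlgebra (𝒜 : ZMod 2 → Submodule k A) [GradedAlgebra 𝒜]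
    {S : Subalgebra k A} (hS : ∀ i, ∀ a ∈ S, GradedAlgebra.proj 𝒜 i a ∈ S) :
    GradedAlgebra (inducedGrading 𝒜 S) where
  one_mem := SetLike.one_mem_graded 𝒜
  mul_mem _ _ _ _ ha hb := SetLike.mul_mem_graded (A := 𝒜) ha hb
  toDecomposition := (isInternal_inducedGrading 𝒜 hS).chooseDecomposition

lemma isEvenEquiv_of_sup_eq_top {𝒜 : ZMod 2 → Submodule k A} {ℬ : ZMod 2 → Submodule k B}
    [GradedAlgebra ℬ] {e : A ≃ₐ[k] B} (he : ∀ i, ∀ a ∈ 𝒜 i, e a ∈ ℬ i)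
    (htop : 𝒜 0 ⊔ 𝒜 1 = ⊤) : IsEvenEquiv 𝒜 ℬ e := by
  have hle (i : ZMod 2) : (𝒜 i).map e.toAlgHom.toLinearMap ≤ ℬ i :=
    Submodule.map_le_iff_le_comap.2 (he i)
  have hsup : (𝒜 0).map e.toAlgHom.toLinearMap ⊔ (𝒜 1).map e.toAlgHom.toLinearMap = ⊤ := by
    rw [← Submodule.map_sup, htop, Submodule.map_top, LinearMap.range_eq_top]
    exact e.surjective
  have hinf : ℬ 0 ⊓ ℬ 1 = ⊥ := (isCompl_even_odd ℬ).inf_eq_bot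
  intro i
  obtain rfl | rfl := eq_zero_or_one_of_zmod_two i
  · exact eq_of_le_of_inf_le_of_le_sup (hle 0) (hinf.trans_le bot_le)
      (le_top.trans (hsup.ge.trans (sup_le_sup_left (hle 1) _)))
  · refine eq_of_le_of_inf_le_of_le_sup (hle 1) ((inf_comm _ _).trans_le (hinf.trans_le bot_le))
      (le_top.trans (hsup.ge.trans ?_))
    exact sup_comm (ℬ 0) _ ▸ sup_le_sup_right (hle 0) _

lemma tensorGrading_sup_eq_top (𝒜 : ZMod 2 → Submodule k A) (ℬ : ZMod 2 → Submodule k B)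
    [GradedAlgebra 𝒜] [GradedAlgebra ℬ] : tensorGrading 𝒜 ℬ 0 ⊔ tensorGrading 𝒜 ℬ 1 = ⊤ := by
  have hsup (i : ZMod 2) :
      tensorGrading 𝒜 ℬ i ≤ tensorGrading 𝒜 ℬ 0 ⊔ tensorGrading 𝒜 ℬ 1 := by
    obtain rfl | rfl := eq_zero_or_one_of_zmod_two i
    exacts [le_sup_left, le_sup_right]
  refine (Submodule.eq_top_iff').2 fun t => ?_
  rw [← (GradedTensorProduct.of k 𝒜 ℬ).apply_symm_apply t]
  induction (GradedTensorProduct.of k 𝒜 ℬ).symm t with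
  | zero => rw [map_zero]; exact zero_mem _
  | add x y hx hy => rw [map_add]; exact add_mem hx hy
  | tmul a b =>
    induction a using homogeneous_induction (𝒜 := 𝒜) with
    | hadd x y hx hy => rw [TensorProduct.add_tmul, map_add]; exact add_mem hx hy
    | h i a ha =>
    induction b using homogeneous_induction (𝒜 := ℬ) with
    | hadd x y hx hy => rw [TensorProduct.tmul_add, map_add]; exact add_mem hx hy
    | h j b hb => exact hsup (i + j) (Submodule.subset_span ⟨i, j, rfl, a, ha, b, hb, rfl⟩)

lemma exists_isEvenEquiv_of_bijective_mul (𝒜 : ZMod 2 → Submodule k A)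
    (ℬ : ZMod 2 → Submodule k B) {𝒞 : ZMod 2 → Submodule k C} [GradedAlgebra 𝒜]
    [GradedAlgebra ℬ] [GradedAlgebra 𝒞] [IsSuperCommutative 𝒞] {f : A →ₐ[k] C} {g : B →ₐ[k] C}
    (hf : ∀ i, ∀ a ∈ 𝒜 i, f a ∈ 𝒞 i) (hg : ∀ i, ∀ b ∈ ℬ i, g b ∈ 𝒞 i) (hg0 : ∀ b, g b ∈ 𝒞 0)
    (hbij : Function.Bijective
      (LinearMap.mul' k C ∘ₗ TensorProduct.map f.toLinearMap g.toLinearMap)) :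
    ∃ e : 𝒜 ᵍ⊗[k] ℬ ≃ₐ[k] C, IsEvenEquiv (tensorGrading 𝒜 ℬ) 𝒞 e ∧
      ∀ a b, e (GradedTensorProduct.tmul k a b) = f a * g b := by
  have hcomm ⦃i j : ZMod 2⦄ (a : 𝒜 i) (b : ℬ j) :
      f a * g b = (-1 : ℤˣ) ^ (j * i) • (g b * f a) := by
    obtain rfl | rfl := eq_zero_or_one_of_zmod_two j
    · rw [zero_mul, uzpow_zero, one_smul, even_mul_comm (hg0 b)]
    · have hgb : g b = 0 := Submodule.disjoint_def.1 (isCompl_even_odd 𝒞).disjoint _ (hg0 b)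
        (hg 1 b b.2)
      rw [hgb, mul_zero, zero_mul, smul_zero]
  let l := GradedTensorProduct.lift 𝒜 ℬ f g hcomm
  have hl (a : A) (b : B) : l (GradedTensorProduct.tmul k a b) = f a * g b :=
    GradedTensorProduct.lift_tmul 𝒜 ℬ f g hcomm a b
  have hl_even (i : ZMod 2) : tensorGrading 𝒜 ℬ i ≤ (𝒞 i).comap l.toLinearMap := by
    refine Submodule.span_le.2 ?_
    rintro _ ⟨p, q, rfl, a, ha, b, hb, rfl⟩
    rw [SetLike.mem_coe, Submodule.mem_comap, AlgHom.toLinearMap_apply, hl]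
    exact SetLike.mul_mem_graded (hf p a ha) (hg q b hb)
  exact ⟨AlgEquiv.ofBijective l hbij,
    isEvenEquiv_of_sup_eq_top (fun i _ ht => hl_even i ht) (tensorGrading_sup_eq_top 𝒜 ℬ), hl⟩

lemma odd_pow_le {𝒜 : ZMod 2 → Submodule k A} [GradedAlgebra 𝒜] (n : ℕ) : 𝒜 1 ^ n ≤ 𝒜 n := by
  induction n with
  | zero =>
    rw [pow_zero, Nat.cast_zero, Submodule.one_le]
    exact SetLike.one_mem_graded 𝒜
  | succ n ih =>
    rw [pow_succ, Nat.cast_succ, Submodule.mul_le]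
    exact fun a ha b hb => SetLike.mul_mem_graded (ih ha) hb

lemma superPolyGrading_le_comap {s : ℕ} {𝒜 : ZMod 2 → Submodule k A} [GradedAlgebra 𝒜]
    {f : SuperPoly k s →ₐ[k] A} (hf : ∀ v, f (ExteriorAlgebra.ι k v) ∈ 𝒜 1) (i : ZMod 2) :
    superPolyGrading k s i ≤ (𝒜 i).comap f.toLinearMap := by
  have hpow (n : ℕ) : LinearMap.range (ExteriorAlgebra.ι k) ^ n ≤
      (𝒜 n).comap f.toLinearMap := by
    rw [← Submodule.map_le_iff_le_comap, Submodule.map_pow]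
    refine le_trans (pow_le_pow_left' ?_ n) (odd_pow_le n)
    rintro _ ⟨_, ⟨v, rfl⟩, rfl⟩
    exact hf v
  refine iSup_le ?_
  rintro ⟨n, rfl⟩
  exact hpow n

end Gradings

lemma natCast_ne_zero_of_le_of_lt_ringChar {R : Type*} [NonAssocSemiring R] {n s : ℕ}
    (hchar : ringChar R = 0 ∨ s < ringChar R) (hpos : 0 < n) (hn : n ≤ s) : (n : R) ≠ 0 := by
  rw [Ne, ringChar.spec]
  intro hdvd
  have hle := Nat.le_of_dvd hpos hdvd
  rcases hchar with h0 | hlt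
  · exact hpos.ne' (zero_dvd_iff.1 (h0 ▸ hdvd))
  · lia

end SuperHopf

end

theorem mainTheorem7 {k A : Type*} [Field k] (hk : ringChar k ≠ 2) [Ring A] [Algebra k A]
    (𝒜 : ZMod 2 → Submodule k A) [GradedAlgebra 𝒜] [Coalgebra k A]
    [IsSuperAffineHopfAlgebra 𝒜] (s : ℕ) (hs : s = Module.finrank k (gMinus 𝒜))
    (hchar : ringChar k = 0 ∨ s < ringChar k) :
    Module.Finite k (gMinus 𝒜) ∧
    (∃ (θ : Fin s → A) (D' : Fin s → A →ₗ[k] A), IsAdapted 𝒜 θ D') ∧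
    ∀ (θ : Fin s → A) (D' : Fin s → A →ₗ[k] A), IsAdapted 𝒜 θ D' →
      ∃ AG Btilde : Subalgebra k A,
        Subalgebra.toSubmodule AG = invariants 𝒜 ∧
        Subalgebra.toSubmodule Btilde = LinearMap.ker (eulerDerivation θ D') ∧
        -- `π : B̃ → B` is an isomorphism of algebras, and it is even
        Function.Bijective ((piMap 𝒜).comp Btilde.val) ∧
        Subalgebra.toSubmodule Btilde ≤ 𝒜 0 ∧
        -- `A^G` and `B̃` are graded subalgebras
        ∃ (_ : GradedAlgebra (inducedGrading 𝒜 AG)) (_ : GradedAlgebra (inducedGrading 𝒜 Btilde)),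
          -- `A = A^G ⊗^ε B̃` through multiplication
          (∃ e : (inducedGrading 𝒜 AG) ᵍ⊗[k] (inducedGrading 𝒜 Btilde) ≃ₐ[k] A,
            IsEvenEquiv (tensorGrading (inducedGrading 𝒜 AG) (inducedGrading 𝒜 Btilde)) 𝒜 e ∧
            ∀ (x : AG) (b : Btilde), e (GradedTensorProduct.tmul k x b) = (x : A) * (b : A)) ∧
          -- `k[θ₁, …, θₛ] ≅ A^G` and `k[θ₁, …, θₛ] ⊗^ε B̃ ≅ A`
          ∃ f : SuperPoly k s ≃ₐ[k] AG,
            IsEvenEquiv (superPolyGrading k s) (inducedGrading 𝒜 AG) f ∧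
            (∀ i, (f (superPolyVar k i) : A) = θ i) ∧
            ∃ e : (superPolyGrading k s) ᵍ⊗[k] (inducedGrading 𝒜 Btilde) ≃ₐ[k] A,
              IsEvenEquiv (tensorGrading (superPolyGrading k s) (inducedGrading 𝒜 Btilde)) 𝒜 e ∧
              ∀ (p : SuperPoly k s) (b : Btilde),
                e (GradedTensorProduct.tmul k p b) = (f p : A) * (b : A) := by
  have hcast (n : ℕ) (hpos : 0 < n) (hn : n ≤ s) : (n : k) ≠ 0 :=
    natCast_ne_zero_of_le_of_lt_ringChar hchar hpos hn
  refine ⟨finite_gMinus 𝒜, exists_isAdapted 𝒜 hk hs, fun θ D' h => ?_⟩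
  let gradedAG := inducedGradedAlgebra 𝒜 (S := coinvariants (coactionHom 𝒜))
    fun i _ ha => proj_mem_invariants i ha
  let gradedB := inducedGradedAlgebra 𝒜 (S := h.kerEuler) fun i _ ha => h.proj_mem_kerEuler i ha
  have heven (b : h.kerEuler) : (b : A) ∈ 𝒜 0 := h.kerEuler_le_even hk hcast b.2
  have hpoly (i : ZMod 2) : ∀ x ∈ superPolyGrading k s i, h.polyHom hk x ∈ 𝒜 i :=
    superPolyGrading_le_comap (fun v => h.polyHom_ι hk v ▸ h.linearCombination_odd v) i
  refine ⟨coinvariants (coactionHom 𝒜), h.kerEuler, rfl, rfl, h.bijective_piMap_kerEuler hk hcast,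
    h.kerEuler_le_even hk hcast, gradedAG, gradedB, ?_, h.polyEquiv hk hcast, ?_, ?_, ?_⟩
  · exact exists_isEvenEquiv_of_bijective_mul _ _ (fun _ _ ha => ha) (fun _ _ hb => hb) heven
      (h.bijective_coinvariants_mul_kerEuler hk hcast)
  · exact isEvenEquiv_of_sup_eq_top hpoly (isCompl_even_odd (superPolyGrading k s)).sup_eq_top
  · exact h.polyHom_superPolyVar hk
  · exact exists_isEvenEquiv_of_bijective_mul _ _ hpoly (fun _ _ hb => hb) heven
      (h.bijective_polyHom_mul_kerEuler hk hcast)
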